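/- Let $G=(V,E)$ be a finite undirected graph with edge weights $w:E\to\mathbb{R}_{\ge 0}$, and write $w(C)=\sum_{e\in C}w(e)$ for $C\subseteq E$. For $q\ge 1$ and candidate sets $T_1,\dots,T_q\subseteq V$, the problem Single-to-Single asks for a set $C\subseteq E$ of minimum weight such that there are representatives $t_i\in T_i$ $(i=1,\dots,q)$ lying in pairwise different components of $G-C$; assume that at least one such $C$ exists. A Gomory--Hu tree of $(G,w)$ is a tree $H$ on $V$ with edge weights $w_H$ such that for all distinct $s,t\in V$ and every edge $e$ of minimum $w_H$-weight on the $s$--$t$ path of $H$, the set $U(e)$ of edges of $G$ that join the two components of $H-e$ is a minimum-weight $s$--$t$ cut of $(G,w)$, and $w_H(e)=w(U(e))$. A set $F\subseteq E(H)$ is good if one can choose representatives of $|F|+1$ of the candidate sets so that each component of $H-F$ contains exactly one of the chosen representatives. The greedy algorithm on $H$ starts with $F=\emptyset$ and, while $|F|<q-1$, adds to $F$ an edge $e\notin F$ of minimum $w_H$-weight among those for which $F+e$ is good (ties are broken arbitrarily). The approximation algorithm computes a Gomory--Hu tree $H$ of $(G,w)$, runs the greedy algorithm on $H$, and returns $\bigcup_{e\in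 F}U(e)$ for the set $F$ obtained. (i) The approximation algorithm can always be carried out: a Gomory--Hu tree exists, and on every Gomory--Hu tree the greedy algorithm never gets stuck. The greedy output $F$ is an optimal solution of Single-to-Single on $(H,w_H)$ with the candidate sets $T_1,\dots,T_q$. (ii) Whatever Gomory--Hu tree is used and however ties are broken, the returned set is a feasible solution of Single-to-Single on $(G,w)$, and its weight is at most $\left(2-\frac{2}{q}\right)$ times the optimum. (iii) Single-to-Single generalizes $k$-Cut (find a minimum-weight $C\subseteq E$ such that $G-C$ has at least $k$ components): for every $k$, the feasible solutions of Single-to-Single on $G$ with $T_1=\dots=T_k=V$ are exactly the feasible solutions of $k$-Cut on $G$. Hence, for every real $\rho$, the $\rho$-approximate solutions of the two problems coincide. -/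

import Mathlib

/-!
Graphs are finite and simple on a vertex type `V`; a set of edges is a `Finset (Sym2 V)`; only the
values of a weight function `Sym2 V → ℝ` on edges of the graph matter.
-/

/-- `w(C) = ∑_{e ∈ C} w(e)`. -/
def edgeSetWeight {V : Type*} (w : Sym2 V → ℝ) (C : Finset (Sym2 V)) : ℝ :=
  ∑ e ∈ C, w e

/-- `C ⊆ E(G)`, and `s`, `t` lie in different components of `G - C`. -/
def IsSeparatingCut {V : Type*} (G : SimpleGraph V) (s t : V) (C : Finset (Sym2 V)) : Prop :=
  (C : Set (Sym2 V)) ⊆ G.edgeSet ∧ ¬ (G.deleteEdges (C : Set (Sym2 V))).Reachable s t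

/-- `C` is a solution of the minimization problem over the edge sets satisfying `Feasible`, and its
weight is at most `ρ` times the weight of every solution (equivalently, of an optimal one). -/
def IsApproxSolution {V : Type*} (Feasible : Finset (Sym2 V) → Prop) (w : Sym2 V → ℝ) (ρ : ℝ)
    (C : Finset (Sym2 V)) : Prop :=
  Feasible C ∧ ∀ C', Feasible C' → edgeSetWeight w C ≤ ρ * edgeSetWeight w C'

/-- Feasible solutions of Single-to-Single: edge sets `C ⊆ E(G)` such that there are
representatives `t i ∈ T i` lying in pairwise different components of `G - C`. -/
def IsSingleToSingleCut {V : Type*} (G : SimpleGraph V) {q : ℕ} (T : Fin q → Set V)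
    (C : Finset (Sym2 V)) : Prop :=
  (C : Set (Sym2 V)) ⊆ G.edgeSet ∧
    ∃ t : Fin q → V, (∀ i, t i ∈ T i) ∧
      ∀ i j, i ≠ j → ¬ (G.deleteEdges (C : Set (Sym2 V))).Reachable (t i) (t j)

/-- Feasible solutions of `k`-Cut: edge sets whose deletion breaks `G` into at least `k`
components. -/
def IsKCut {V : Type*} (G : SimpleGraph V) (k : ℕ) (C : Finset (Sym2 V)) : Prop :=
  (C : Set (Sym2 V)) ⊆ G.edgeSet ∧
    k ≤ Nat.card (G.deleteEdges (C : Set (Sym2 V))).ConnectedComponent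

open Classical in
/-- The cut of `G` corresponding to the edge `e` of a tree `H` on the same vertices: the edges of
`G` whose ends lie in different components of `H - e`. -/
noncomputable def treeEdgeCut {V : Type*} [Fintype V] [DecidableEq V] (G H : SimpleGraph V)
    (e : Sym2 V) : Finset (Sym2 V) :=
  Finset.univ.filter fun f =>
    f ∈ G.edgeSet ∧ ∃ u v : V, f = s(u, v) ∧ ¬ (H.deleteEdges {e}).Reachable u v

/-- `(H, wH)` is a Gomory-Hu tree of `(G, w)`: for distinct `s`, `t` and an edge `e` of minimum
`wH`-weight on the `s`-`t` path of `H`, the two components of `H - e` are the sides of a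
minimum-weight `s`-`t` cut of `G`, and `wH e` is the weight of that cut. -/
structure IsGomoryHuTree {V : Type*} [Fintype V] [DecidableEq V] (G : SimpleGraph V)
    (w : Sym2 V → ℝ) (H : SimpleGraph V) (wH : Sym2 V → ℝ) : Prop where
  isTree : H.IsTree
  minCut : ∀ (s t : V) (p : H.Walk s t), s ≠ t → p.IsPath →
    ∀ e ∈ p.edges, (∀ e' ∈ p.edges, wH e ≤ wH e') →
      IsApproxSolution (IsSeparatingCut G s t) w 1 (treeEdgeCut G H e) ∧
        wH e = edgeSetWeight w (treeEdgeCut G H e)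

/-- Good cuts `C` of a tree `H`: one can choose `|C| + 1` representatives, of pairwise different
candidate sets `T i` (`i ∈ I`), so that each component of `H - C` contains exactly one of them. -/
def IsGoodCut {V : Type*} (H : SimpleGraph V) {q : ℕ} (T : Fin q → Set V)
    (C : Finset (Sym2 V)) : Prop :=
  (C : Set (Sym2 V)) ⊆ H.edgeSet ∧
    ∃ (I : Finset (Fin q)) (t : Fin q → V), I.card = C.card + 1 ∧ (∀ i ∈ I, t i ∈ T i) ∧
      ∀ K : (H.deleteEdges (C : Set (Sym2 V))).ConnectedComponent,
        ∃! i, i ∈ I ∧ (H.deleteEdges (C : Set (Sym2 V))).connectedComponentMk (t i) = K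

/-- One iteration of the greedy loop on `H`: while `|C| < q - 1`, add to `C` an edge `e` of minimum
weight among those for which `C + e` is good (with an arbitrary choice in case of ties). -/
def GreedyStep {V : Type*} [DecidableEq V] (H : SimpleGraph V) (wH : Sym2 V → ℝ) {q : ℕ}
    (T : Fin q → Set V) (C C' : Finset (Sym2 V)) : Prop :=
  C.card + 1 < q ∧
    ∃ e, e ∈ H.edgeSet ∧ e ∉ C ∧ IsGoodCut H T (insert e C) ∧
      (∀ e', e' ∈ H.edgeSet → e' ∉ C → IsGoodCut H T (insert e' C) → wH e ≤ wH e') ∧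
      C' = insert e C

/-- `C` occurs in some run of the greedy algorithm, which starts with the empty set. -/
def GreedyReachable {V : Type*} [DecidableEq V] (H : SimpleGraph V) (wH : Sym2 V → ℝ) {q : ℕ}
    (T : Fin q → Set V) (C : Finset (Sym2 V)) : Prop :=
  Relation.ReflTransGen (GreedyStep H wH T) ∅ C

/-- `C` is a possible output of the greedy algorithm: the loop condition `|C| < q - 1` fails. -/
def IsGreedyOutput {V : Type*} [DecidableEq V] (H : SimpleGraph V) (wH : Sym2 V → ℝ) {q : ℕ}
    (T : Fin q → Set V) (C : Finset (Sym2 V)) : Prop :=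
  GreedyReachable H wH T C ∧ ¬ C.card + 1 < q

/-- `D` is a possible output of the approximation algorithm for Single-to-Single: compute a
Gomory-Hu tree of `G`, run the greedy algorithm on it, and return the union of the cuts of `G`
corresponding to the tree edges found. -/
def IsGomoryHuGreedyOutput {V : Type*} [Fintype V] [DecidableEq V] (G : SimpleGraph V)
    (w : Sym2 V → ℝ) {q : ℕ} (T : Fin q → Set V) (D : Finset (Sym2 V)) : Prop :=
  ∃ (H : SimpleGraph V) (wH : Sym2 V → ℝ) (F : Finset (Sym2 V)),
    IsGomoryHuTree G w H wH ∧ IsGreedyOutput H wH T F ∧ D = F.biUnion (treeEdgeCut G H)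

/-! Greedy is exact on a tree because good cuts satisfy a matroid-like exchange property. Deleting
`F` from a tree leaves `|F| + 1` components, so `F` is good iff these components have a system of
distinct candidate sets (`isGoodCut_iff`), which Hall's theorem governs. If no edge of a solution
`C` can be added to `F`, each edge of `C` outside `F` creates a component whose candidate indices
all lie in the neighbourhood of a tight family, one with equality in Hall's condition. Tight
families are closed under union, and counting outside the largest one gives `q ≤ |F| + 1`
(`card_le_of_forall_not_hasTransversal`). Hence a short good cut can be enlarged inside any solution
(`IsGoodCut.exists_insert`), and the usual exchange argument proves optimality.

For the ratio, let `X i` be the components of the representatives `t i` in `G - C`. Each edge of `C`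
bounds at most two of them, so the boundaries weigh at most `2 w(C)` together, and at most `2 - 2/q`
times `w(C)` without the heaviest, of index `i₀`. Root the tree at `t i₀` and, for `i ≠ i₀`, take
the edge by which the path from `t i` to the root first leaves `X i`. These edges separate the
representatives, and each weighs at most the boundary of `X i`, which is a cut between its ends. So
the tree optimum obeys the bound, and passing back to `G` does not increase the weight.

A Gomory-Hu tree is grown from a star. Vertices are settled one by one, by splitting a settled
vertex along a minimum cut that has been uncrossed from the branches there. -/

/-! ### Reachability and deleted edges -/

section Reachability

variable {V : Type*} {J : SimpleGraph V}

/-- A function that is constant along edges is constant on components. -/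
theorem SimpleGraph.Reachable.apply_eq_of_adj {α : Type*} {f : V → α}
    (hf : ∀ a b, J.Adj a b → f a = f b) {x y : V} (h : J.Reachable x y) : f x = f y := by
  obtain ⟨p⟩ := h
  induction p with
  | nil => rfl
  | cons hab _ ih => exact (hf _ _ hab).trans ih

/-- Of a walk that uses the edge, keep the part before its first use and the part after its last
use. -/
theorem SimpleGraph.Reachable.deleteEdges_or {x y : V} (h : J.Reachable x y) (a b : V) :
    (J.deleteEdges {s(a, b)}).Reachable x y ∨
      ((J.deleteEdges {s(a, b)}).Reachable x a ∧ (J.deleteEdges {s(a, b)}).Reachable b y) ∨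
      ((J.deleteEdges {s(a, b)}).Reachable x b ∧ (J.deleteEdges {s(a, b)}).Reachable a y) := by
  obtain ⟨p⟩ := h
  induction p with
  | nil => exact Or.inl .rfl
  | @cons u v w huv _ ih =>
    by_cases he : s(u, v) = s(a, b)
    · rcases Sym2.eq_iff.1 he with ⟨rfl, rfl⟩ | ⟨rfl, rfl⟩
      · rcases ih with h | ⟨h1, h2⟩ | ⟨h1, h2⟩
        · exact Or.inr (Or.inl ⟨.rfl, h⟩)
        · exact Or.inr (Or.inl ⟨.rfl, h2⟩)
        · exact Or.inl h2
      · rcases ih with h | ⟨h1, h2⟩ | ⟨h1, h2⟩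
        · exact Or.inr (Or.inr ⟨.rfl, h⟩)
        · exact Or.inl h2
        · exact Or.inr (Or.inr ⟨.rfl, h2⟩)
    · have huv' : (J.deleteEdges {s(a, b)}).Reachable u v :=
        SimpleGraph.Adj.reachable (by simpa [he] using huv)
      rcases ih with h | ⟨h1, h2⟩ | ⟨h1, h2⟩
      · exact Or.inl (huv'.trans h)
      · exact Or.inr (Or.inl ⟨huv'.trans h1, h2⟩)
      · exact Or.inr (Or.inr ⟨huv'.trans h1, h2⟩)

/-- Deleting one edge: the map from the new components to the old ones. -/
def mergeComp (J : SimpleGraph V) (e : Sym2 V) (K : (J.deleteEdges {e}).ConnectedComponent) :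
    J.ConnectedComponent :=
  K.map (SimpleGraph.Hom.ofLE (J.deleteEdges_le {e}))

@[simp] theorem mergeComp_mk (e : Sym2 V) (v : V) :
    mergeComp J e ((J.deleteEdges {e}).connectedComponentMk v) = J.connectedComponentMk v := rfl

/-- Restoring `s(a, b)` can only merge the components of `a` and `b`, so leaving out that of `a`
removes every collision. -/
theorem mergeComp_injOn (a b : V) :
    Set.InjOn (mergeComp J s(a, b)) {(J.deleteEdges {s(a, b)}).connectedComponentMk a}ᶜ := by
  intro K hK L hL h
  induction K using SimpleGraph.ConnectedComponent.ind with | _ x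
  induction L using SimpleGraph.ConnectedComponent.ind with | _ y
  simp only [Set.mem_compl_iff, Set.mem_singleton_iff, SimpleGraph.ConnectedComponent.eq] at hK hL
  simp only [mergeComp_mk, SimpleGraph.ConnectedComponent.eq] at h ⊢
  rcases h.deleteEdges_or a b with h | ⟨h1, h2⟩ | ⟨h1, h2⟩
  · exact h
  · exact absurd h1 hK
  · exact absurd h2.symm hL

theorem mergeComp_surjOn {a b : V} (hab : J.Adj a b)
    (hb : ¬ (J.deleteEdges {s(a, b)}).Reachable a b) :
    Set.SurjOn (mergeComp J s(a, b))
      {(J.deleteEdges {s(a, b)}).connectedComponentMk a}ᶜ Set.univ := by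
  intro K _
  induction K using SimpleGraph.ConnectedComponent.ind with | _ x
  by_cases hx : (J.deleteEdges {s(a, b)}).Reachable x a
  · refine ⟨(J.deleteEdges {s(a, b)}).connectedComponentMk b, ?_, ?_⟩
    · simpa [SimpleGraph.ConnectedComponent.eq] using fun h => hb h.symm
    · simp only [mergeComp_mk, SimpleGraph.ConnectedComponent.eq]
      exact hab.symm.reachable.trans (hx.symm.mono (J.deleteEdges_le _))
  · exact ⟨(J.deleteEdges {s(a, b)}).connectedComponentMk x,
      by simpa [SimpleGraph.ConnectedComponent.eq] using hx, rfl⟩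

theorem card_connectedComponent_deleteEdges_singleton [Finite V] {a b : V} (hab : J.Adj a b)
    (hb : ¬ (J.deleteEdges {s(a, b)}).Reachable a b) :
    Nat.card (J.deleteEdges {s(a, b)}).ConnectedComponent = Nat.card J.ConnectedComponent + 1 := by
  have h := Set.BijOn.mk (fun _ _ => Set.mem_univ _) (mergeComp_injOn a b) (mergeComp_surjOn hab hb)
  have h1 := Set.ncard_congr' h.equiv
  rw [Set.ncard_univ] at h1
  have h2 := Set.ncard_add_ncard_compl {(J.deleteEdges {s(a, b)}).connectedComponentMk a}
  rw [Set.ncard_singleton] at h2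
  omega

theorem SimpleGraph.deleteEdges_insert [DecidableEq V] (e : Sym2 V) (F : Finset (Sym2 V)) :
    J.deleteEdges ((insert e F : Finset (Sym2 V)) : Set (Sym2 V)) =
      (J.deleteEdges (F : Set (Sym2 V))).deleteEdges {e} := by
  rw [SimpleGraph.deleteEdges_deleteEdges, Finset.coe_insert, Set.union_comm,
    Set.singleton_union]

theorem SimpleGraph.IsTree.card_connectedComponent_deleteEdges [Finite V] [DecidableEq V]
    {H : SimpleGraph V} (hH : H.IsTree) (F : Finset (Sym2 V))
    (hF : (F : Set (Sym2 V)) ⊆ H.edgeSet) :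
    Nat.card (H.deleteEdges (F : Set (Sym2 V))).ConnectedComponent = F.card + 1 := by
  induction F using Finset.induction_on with
  | empty =>
    have := hH.1.preconnected.subsingleton_connectedComponent
    have := hH.1.nonempty
    rw [Finset.coe_empty, SimpleGraph.deleteEdges_empty, Finset.card_empty, zero_add,
      Nat.card_eq_one_iff_unique]
    exact ⟨inferInstance, inferInstance⟩
  | insert e F he ih =>
    rw [Finset.coe_insert, Set.insert_subset_iff] at hF
    rw [SimpleGraph.deleteEdges_insert]
    induction e with | _ a b
    have hab : (H.deleteEdges (F : Set (Sym2 V))).Adj a b := by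
      simpa [he] using hF.1
    rw [card_connectedComponent_deleteEdges_singleton hab, ih hF.2, Finset.card_insert_of_notMem he]
    exact SimpleGraph.isBridge_iff.1 (SimpleGraph.isAcyclic_iff_forall_adj_isBridge.1
      (hH.2.anti (SimpleGraph.deleteEdges_le _)) hab)

/-- Paths in a forest are unique, so a path avoiding `e` would have to be `p` itself. -/
theorem SimpleGraph.IsAcyclic.not_reachable_deleteEdges_of_mem_edges (hJ : J.IsAcyclic) {x y : V}
    {p : J.Walk x y} (hp : p.IsPath) {e : Sym2 V} (he : e ∈ p.edges) :
    ¬ (J.deleteEdges {e}).Reachable x y := by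
  intro hr
  obtain ⟨r, hr⟩ := hr.exists_isPath
  have hle := J.deleteEdges_le {e}
  have hpr : p = r.mapLe hle := congrArg Subtype.val
    ((hJ.subsingleton_path x y).elim ⟨p, hp⟩ ⟨r.mapLe hle, hr.mapLe hle⟩)
  rw [hpr, SimpleGraph.Walk.edges_mapLe_eq_edges] at he
  have := r.edges_subset_edgeSet he
  simp at this

/-- In an acyclic graph, an edge set that separates two vertices of the same component contains
a single edge that separates them. -/
theorem SimpleGraph.IsAcyclic.exists_not_reachable_deleteEdges_singleton (hJ : J.IsAcyclic)
    {x y : V} (h : J.Reachable x y) {C : Set (Sym2 V)} (hC : ¬ (J.deleteEdges C).Reachable x y) :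
    ∃ e ∈ C, e ∈ J.edgeSet ∧ ¬ (J.deleteEdges {e}).Reachable x y := by
  obtain ⟨p, hp⟩ := h.exists_isPath
  obtain ⟨e, he, hep⟩ := SimpleGraph.Walk.exists_mem_edges_of_not_reachable_deleteEdges p hC
  exact ⟨e, he, p.edges_subset_edgeSet hep, hJ.not_reachable_deleteEdges_of_mem_edges hp hep⟩

end Reachability

/-! ### Systems of distinct representatives and good cuts -/

section Transversal

variable {V : Type*} {J : SimpleGraph V} {q : ℕ} {T : Fin q → Set V}

open Classical in
/-- The indices of the candidate sets that meet the component `K`. -/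
noncomputable def compIdx (J : SimpleGraph V) (T : Fin q → Set V) (K : J.ConnectedComponent) :
    Finset (Fin q) :=
  Finset.univ.filter fun i => ∃ v ∈ T i, J.connectedComponentMk v = K

theorem mem_compIdx {K : J.ConnectedComponent} {i : Fin q} :
    i ∈ compIdx J T K ↔ ∃ v ∈ T i, J.connectedComponentMk v = K := by
  simp [compIdx]

/-- The components of `J` have a system of distinct candidate sets meeting them. -/
def HasTransversal (J : SimpleGraph V) (T : Fin q → Set V) : Prop :=
  ∃ f : J.ConnectedComponent → Fin q, Function.Injective f ∧ ∀ K, f K ∈ compIdx J T K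

/-- Hall's marriage theorem. -/
theorem hasTransversal_iff :
    HasTransversal J T ↔ ∀ s : Finset J.ConnectedComponent, s.card ≤ (s.biUnion (compIdx J T)).card :=
  (Finset.all_card_le_biUnion_card_iff_exists_injective (compIdx J T)).symm

theorem HasTransversal.mono {J' : SimpleGraph V} (h : HasTransversal J' T) (hle : J' ≤ J) :
    HasTransversal J T := by
  obtain ⟨f, hf, hfT⟩ := h
  have hs := SimpleGraph.ConnectedComponent.surjective_map_ofLE hle
  refine ⟨fun K => f (Function.surjInv hs K), hf.comp (Function.injective_surjInv hs), fun K => ?_⟩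
  obtain ⟨v, hv, hvK⟩ := mem_compIdx.1 (hfT (Function.surjInv hs K))
  refine mem_compIdx.2 ⟨v, hv, ?_⟩
  rw [← Function.surjInv_eq hs K, ← hvK]
  rfl

open Classical in
/-- The case of `exists_tight_of_not_hasTransversal` where the deficient family contains the
component of `a`. -/
theorem exists_tight_of_deficient_of_mem (hJ : HasTransversal J T) {a b : V} {e : Sym2 V}
    (he : e = s(a, b))
    {s : Finset (J.deleteEdges {e}).ConnectedComponent}
    (hs : (s.biUnion (compIdx (J.deleteEdges {e}) T)).card < s.card)
    (ha : (J.deleteEdges {e}).connectedComponentMk a ∈ s) :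
    ∃ W : Finset J.ConnectedComponent, (W.biUnion (compIdx J T)).card ≤ W.card ∧
      compIdx (J.deleteEdges {e}) T ((J.deleteEdges {e}).connectedComponentMk a) ⊆
        W.biUnion (compIdx J T) := by
  subst he
  set W := (s.erase ((J.deleteEdges {s(a, b)}).connectedComponentMk a)).image (mergeComp J s(a, b)) with hW
  have hcard : W.card = s.card - 1 := by
    rw [hW, Finset.card_image_of_injOn, Finset.card_erase_of_mem ha]
    refine (mergeComp_injOn a b).mono fun K hK => ?_
    simpa using (Finset.mem_erase.1 (Finset.mem_coe.1 hK)).1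
  have hsub : W.biUnion (compIdx J T) ⊆ s.biUnion (compIdx (J.deleteEdges {s(a, b)}) T) := by
    intro i hi
    obtain ⟨L, hL, hi⟩ := Finset.mem_biUnion.1 hi
    obtain ⟨K, hK, rfl⟩ := Finset.mem_image.1 hL
    obtain ⟨hKa, hK⟩ := Finset.mem_erase.1 hK
    obtain ⟨v, hv, hvK⟩ := mem_compIdx.1 hi
    induction K using SimpleGraph.ConnectedComponent.ind with | _ x
    rw [mergeComp_mk, SimpleGraph.ConnectedComponent.eq] at hvK
    rw [Ne, SimpleGraph.ConnectedComponent.eq] at hKa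
    rcases hvK.deleteEdges_or a b with h | ⟨h, _⟩ | ⟨_, h⟩
    · exact Finset.mem_biUnion.2 ⟨_, hK, mem_compIdx.2 ⟨v, hv, SimpleGraph.ConnectedComponent.eq.2 h⟩⟩
    · exact Finset.mem_biUnion.2 ⟨_, ha, mem_compIdx.2 ⟨v, hv, SimpleGraph.ConnectedComponent.eq.2 h⟩⟩
    · exact absurd h.symm hKa
  -- Writing `N` for the set of indices met, Hall gives `|W| ≤ |N(W)| ≤ |N(s)| ≤ |s| - 1 = |W|`. So
  -- equality holds throughout and `N(W) = N(s)`.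
  have hHall := hasTransversal_iff.1 hJ W
  have heq := Finset.eq_of_subset_of_card_le hsub (by omega)
  refine ⟨W, by rw [heq]; omega, ?_⟩
  rw [heq]
  exact Finset.subset_biUnion_of_mem (compIdx (J.deleteEdges {s(a, b)}) T) ha

-- Hall's condition fails for some family `s` after the deletion. If `s` contained neither end's
-- component, merging would give a family of the same size meeting no further indices, so Hall's
-- condition would already fail in `J`.
open Classical in
theorem exists_tight_of_not_hasTransversal (hJ : HasTransversal J T) {a b : V}
    (h : ¬ HasTransversal (J.deleteEdges {s(a, b)}) T) :
    ∃ x, (x = a ∨ x = b) ∧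
      ∃ W : Finset J.ConnectedComponent, (W.biUnion (compIdx J T)).card ≤ W.card ∧
        compIdx (J.deleteEdges {s(a, b)}) T ((J.deleteEdges {s(a, b)}).connectedComponentMk x) ⊆
          W.biUnion (compIdx J T) := by
  rw [hasTransversal_iff] at h
  push Not at h
  obtain ⟨s, hs⟩ := h
  by_cases ha : (J.deleteEdges {s(a, b)}).connectedComponentMk a ∈ s
  · exact ⟨a, Or.inl rfl, exists_tight_of_deficient_of_mem hJ rfl hs ha⟩
  by_cases hb : (J.deleteEdges {s(a, b)}).connectedComponentMk b ∈ s
  · exact ⟨b, Or.inr rfl, exists_tight_of_deficient_of_mem hJ Sym2.eq_swap hs hb⟩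
  exfalso
  have hcard : (s.image (mergeComp J s(a, b))).card = s.card := by
    refine Finset.card_image_of_injOn ((mergeComp_injOn a b).mono fun K hK => ?_)
    rintro rfl
    exact ha hK
  have hsub : (s.image (mergeComp J s(a, b))).biUnion (compIdx J T) ⊆ s.biUnion (compIdx (J.deleteEdges {s(a, b)}) T) := by
    intro i hi
    obtain ⟨L, hL, hi⟩ := Finset.mem_biUnion.1 hi
    obtain ⟨K, hK, rfl⟩ := Finset.mem_image.1 hL
    obtain ⟨v, hv, hvK⟩ := mem_compIdx.1 hi
    induction K using SimpleGraph.ConnectedComponent.ind with | _ x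
    rw [mergeComp_mk, SimpleGraph.ConnectedComponent.eq] at hvK
    rcases hvK.deleteEdges_or a b with h | ⟨_, h⟩ | ⟨_, h⟩
    · exact Finset.mem_biUnion.2 ⟨_, hK, mem_compIdx.2 ⟨v, hv, SimpleGraph.ConnectedComponent.eq.2 h⟩⟩
    · exact absurd (SimpleGraph.ConnectedComponent.eq.2 h ▸ hK) hb
    · exact absurd (SimpleGraph.ConnectedComponent.eq.2 h ▸ hK) ha
  have := hasTransversal_iff.1 hJ (s.image (mergeComp J s(a, b)))
  have := Finset.card_le_card hsub
  omega

open Classical in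
/-- Tight families of components are closed under union, so there is a largest one. -/
theorem exists_largest_tight [Finite V] (hJ : HasTransversal J T) :
    ∃ M : Finset J.ConnectedComponent, (M.biUnion (compIdx J T)).card ≤ M.card ∧
      ∀ W : Finset J.ConnectedComponent, (W.biUnion (compIdx J T)).card ≤ W.card → W ⊆ M := by
  have := Fintype.ofFinite J.ConnectedComponent
  refine ⟨(Finset.univ.filter fun W : Finset J.ConnectedComponent =>
    (W.biUnion (compIdx J T)).card ≤ W.card).sup id, ?_, fun W hW =>
      Finset.le_sup (f := id) (by simpa using hW)⟩
  refine Finset.sup_induction (p := fun W : Finset J.ConnectedComponent =>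
    (W.biUnion (compIdx J T)).card ≤ W.card) (by simp) (fun A hA B hB => ?_) (by simp)
  -- Neighbourhood size is submodular, and Hall bounds it from below on `A ∩ B`; what is left is
  -- tightness of `A ∪ B`.
  have h1 := Finset.card_union_add_card_inter A B
  have h2 := Finset.card_union_add_card_inter (A.biUnion (compIdx J T)) (B.biUnion (compIdx J T))
  have h3 : ((A ∩ B).biUnion (compIdx J T)).card ≤
      (A.biUnion (compIdx J T) ∩ B.biUnion (compIdx J T)).card :=
    Finset.card_le_card (Finset.subset_inter
      (Finset.biUnion_subset_biUnion_of_subset_left _ Finset.inter_subset_left)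
      (Finset.biUnion_subset_biUnion_of_subset_left _ Finset.inter_subset_right))
  have h4 := hasTransversal_iff.1 hJ (A ∩ B)
  have h5 : (A ∪ B).biUnion (compIdx J T) = A.biUnion (compIdx J T) ∪ B.biUnion (compIdx J T) :=
    Finset.union_biUnion
  show ((A ∪ B).biUnion (compIdx J T)).card ≤ (A ∪ B).card
  rw [h5]
  omega

open Classical in
/-- If no edge of `C` can be deleted without destroying all transversals, then representatives that
are separated by `C` are at most as many as the components. -/
theorem card_le_of_forall_not_hasTransversal [Finite V] (hJ : HasTransversal J T)
    {C : Set (Sym2 V)} (hC : ∀ e ∈ C, ¬ HasTransversal (J.deleteEdges {e}) T)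
    {t : Fin q → V} (ht : ∀ i, t i ∈ T i)
    (hsep : ∀ i j, i ≠ j → J.Reachable (t i) (t j) →
      ∃ e ∈ C, ¬ (J.deleteEdges {e}).Reachable (t i) (t j)) :
    q ≤ Nat.card J.ConnectedComponent := by
  have := Fintype.ofFinite J.ConnectedComponent
  obtain ⟨M, hM, hmax⟩ := exists_largest_tight hJ
  set A := M.biUnion (compIdx J T) with hA
  -- Send an index outside `A` to the component of its representative. Two such indices in one
  -- component would be split by an edge of `C`, and one of them would fall into the component whose
  -- indices all lie in `A`. Since `|A| ≤ |M|`, adding up gives the claim.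
  have hinj : Aᶜ.card ≤ Mᶜ.card := by
    refine Finset.card_le_card_of_injOn (fun i => J.connectedComponentMk (t i)) ?_ ?_
    · intro i hi
      simp only [Finset.coe_compl, Set.mem_compl_iff, Finset.mem_coe] at hi ⊢
      exact fun hM => hi (Finset.mem_biUnion.2 ⟨_, hM, mem_compIdx.2 ⟨t i, ht i, rfl⟩⟩)
    · intro i hi j hj hij
      simp only [Finset.coe_compl, Set.mem_compl_iff, Finset.mem_coe] at hi hj
      by_contra hne
      have hreach : J.Reachable (t i) (t j) := SimpleGraph.ConnectedComponent.eq.1 hij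
      obtain ⟨e, he, hnr⟩ := hsep i j hne hreach
      induction e with | _ a b
      obtain ⟨x, hx, W, hW, hxW⟩ := exists_tight_of_not_hasTransversal hJ (hC _ he)
      have hWA : W.biUnion (compIdx J T) ⊆ A :=
        Finset.biUnion_subset_biUnion_of_subset_left _ (hmax W hW)
      have key : ∀ k, (J.deleteEdges {s(a, b)}).Reachable (t k) x → k ∈ A := fun k hk =>
        hWA (hxW (mem_compIdx.2 ⟨t k, ht k, SimpleGraph.ConnectedComponent.eq.2 hk⟩))
      rcases hreach.deleteEdges_or a b with h | ⟨h1, h2⟩ | ⟨h1, h2⟩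
      · exact hnr h
      · rcases hx with rfl | rfl
        · exact hi (key i h1)
        · exact hj (key j h2.symm)
      · rcases hx with rfl | rfl
        · exact hj (key j h2.symm)
        · exact hi (key i h1)
  have h1 := Finset.card_add_card_compl A
  have h2 := Finset.card_add_card_compl M
  rw [Fintype.card_fin] at h1
  rw [Nat.card_eq_fintype_card]
  omega

/-- In a tree, good cuts are those whose components have a transversal. -/
theorem isGoodCut_iff [Finite V] [DecidableEq V] {H : SimpleGraph V} (hH : H.IsTree)
    {F : Finset (Sym2 V)} :
    IsGoodCut H T F ↔
      (F : Set (Sym2 V)) ⊆ H.edgeSet ∧ HasTransversal (H.deleteEdges (F : Set (Sym2 V))) T := by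
  refine and_congr_right fun hF => ⟨?_, ?_⟩
  · rintro ⟨I, t, -, htT, ht⟩
    choose f hf _ using ht
    refine ⟨f, fun K L h => ?_, fun K => mem_compIdx.2 ⟨t (f K), htT _ (hf K).1, (hf K).2⟩⟩
    rw [← (hf K).2, ← (hf L).2, h]
  · rintro ⟨f, hf, hfT⟩
    classical
    have := Fintype.ofFinite (H.deleteEdges (F : Set (Sym2 V))).ConnectedComponent
    choose v hvT hv using fun K => mem_compIdx.1 (hfT K)
    have := hH.1.nonempty
    obtain ⟨g, hg⟩ := hf.hasLeftInverse
    refine ⟨Finset.univ.image f, fun i => v (g i), ?_, ?_, fun K => ⟨f K, ?_, ?_⟩⟩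
    -- The size of `I` is the number of components, which in a tree is `|F| + 1`.
    · rw [Finset.card_image_of_injective _ hf, Finset.card_univ, ← Nat.card_eq_fintype_card,
        hH.card_connectedComponent_deleteEdges F hF]
    · intro i hi
      obtain ⟨K, -, rfl⟩ := Finset.mem_image.1 hi
      simpa only [hg K] using hvT K
    · exact ⟨Finset.mem_image_of_mem _ (Finset.mem_univ _), by simp only [hg K, hv]⟩
    · rintro i ⟨hi, hiK⟩
      obtain ⟨L, -, rfl⟩ := Finset.mem_image.1 hi
      simp only [hg L, hv] at hiK
      rw [hiK]

theorem IsGoodCut.subset [Finite V] [DecidableEq V] {H : SimpleGraph V} (hH : H.IsTree)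
    {F B : Finset (Sym2 V)} (hB : IsGoodCut H T B) (hFB : F ⊆ B) : IsGoodCut H T F := by
  rw [isGoodCut_iff hH] at hB ⊢
  have h : (F : Set (Sym2 V)) ⊆ B := by exact_mod_cast hFB
  exact ⟨h.trans hB.1, hB.2.mono (SimpleGraph.deleteEdges_anti h)⟩

theorem isGoodCut_empty [Finite V] [DecidableEq V] {H : SimpleGraph V} (hH : H.IsTree)
    (hq : 1 ≤ q) (hT : ∀ i, (T i).Nonempty) : IsGoodCut H T ∅ := by
  have := hH.1.preconnected.subsingleton_connectedComponent
  rw [isGoodCut_iff hH, Finset.coe_empty, SimpleGraph.deleteEdges_empty]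
  obtain ⟨v, hv⟩ := hT ⟨0, hq⟩
  exact ⟨Set.empty_subset _, fun _ => ⟨0, hq⟩, fun _ _ _ => Subsingleton.elim _ _,
    fun K => mem_compIdx.2 ⟨v, hv, Subsingleton.elim _ _⟩⟩

/-- The exchange property: a good cut with fewer than `q - 1` edges can be enlarged by an edge of
any given solution of Single-to-Single. -/
theorem IsGoodCut.exists_insert [Finite V] [DecidableEq V] {H : SimpleGraph V} (hH : H.IsTree)
    {F C : Finset (Sym2 V)} (hF : IsGoodCut H T F) (hC : IsSingleToSingleCut H T C)
    (hq : F.card + 1 < q) : ∃ e ∈ C, e ∉ F ∧ IsGoodCut H T (insert e F) := by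
  obtain ⟨hCH, t, ht, hsep⟩ := hC
  by_contra! hcon
  obtain ⟨hFH, hFT⟩ := (isGoodCut_iff hH).1 hF
  have hcard := hH.card_connectedComponent_deleteEdges F hFH
  refine absurd (card_le_of_forall_not_hasTransversal hFT (C := (C : Set (Sym2 V)) \ F)
    ?_ ht ?_) (by omega)
  · rintro e ⟨heC, heF⟩ hT
    refine hcon e heC heF ((isGoodCut_iff hH).2 ⟨?_, ?_⟩)
    · rw [Finset.coe_insert, Set.insert_subset_iff]
      exact ⟨hCH heC, hFH⟩
    · rwa [SimpleGraph.deleteEdges_insert]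
  · intro i j hij hr
    have hac := hH.2.anti (SimpleGraph.deleteEdges_le (F : Set (Sym2 V)))
    obtain ⟨e, heC, he, hnr⟩ := hac.exists_not_reachable_deleteEdges_singleton hr
      (C := (C : Set (Sym2 V))) (fun h => hsep i j hij (h.mono (by
        rw [SimpleGraph.deleteEdges_deleteEdges]
        exact SimpleGraph.deleteEdges_anti Set.subset_union_right)))
    rw [SimpleGraph.edgeSet_deleteEdges] at he
    exact ⟨e, ⟨heC, he.2⟩, hnr⟩

theorem IsGoodCut.exists_extension [Finite V] [DecidableEq V] {H : SimpleGraph V} (hH : H.IsTree)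
    {F C : Finset (Sym2 V)} (hF : IsGoodCut H T F) (hC : IsSingleToSingleCut H T C)
    (hq : F.card + 1 ≤ q) :
    ∃ B, F ⊆ B ∧ B ⊆ F ∪ C ∧ IsGoodCut H T B ∧ B.card + 1 = q := by
  obtain ⟨n, hn⟩ := Nat.exists_eq_add_of_le hq
  induction n generalizing F with
  | zero => exact ⟨F, subset_rfl, Finset.subset_union_left, hF, by omega⟩
  | succ n ih =>
    obtain ⟨e, heC, heF, hgood⟩ := hF.exists_insert hH hC (by omega)
    have hcard := Finset.card_insert_of_notMem heF
    obtain ⟨B, h1, h2, h3, h4⟩ := ih hgood (by omega) (by omega)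
    refine ⟨B, (Finset.subset_insert _ _).trans h1, h2.trans ?_, h3, h4⟩
    rw [Finset.insert_union]
    exact Finset.insert_subset (Finset.mem_union_right _ heC) subset_rfl

/-- With `q - 1` edges all `q` indices are used, so the chosen representatives form a full system.
-/
theorem IsGoodCut.isSingleToSingleCut [Finite V] [DecidableEq V] {H : SimpleGraph V}
    {B : Finset (Sym2 V)} (hB : IsGoodCut H T B) (hq : B.card + 1 = q) :
    IsSingleToSingleCut H T B := by
  obtain ⟨hBH, I, t, hI, htT, ht⟩ := hB
  have hI : I = Finset.univ := by
    rw [← Finset.card_eq_iff_eq_univ, hI, hq, Fintype.card_fin]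
  subst hI
  refine ⟨hBH, t, fun i => htT i (Finset.mem_univ i), fun i j hij hr => hij ?_⟩
  exact (ht _).unique ⟨Finset.mem_univ i, rfl⟩
    ⟨Finset.mem_univ j, (SimpleGraph.ConnectedComponent.eq.2 hr).symm⟩

end Transversal

/-! ### The greedy algorithm on a tree -/

section Greedy

variable {V : Type*} [Finite V] [DecidableEq V] {H : SimpleGraph V} {wH : Sym2 V → ℝ} {q : ℕ}
  {T : Fin q → Set V}

theorem GreedyReachable.isGoodCut (hH : H.IsTree) (hq : 1 ≤ q) (hT : ∀ i, (T i).Nonempty)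
    {F : Finset (Sym2 V)} (hF : GreedyReachable H wH T F) :
    IsGoodCut H T F ∧ F.card + 1 ≤ q := by
  induction hF with
  | refl => exact ⟨isGoodCut_empty hH hq hT, by simpa using hq⟩
  | tail _ hstep _ =>
    obtain ⟨hcard, e, -, he, hgood, -, rfl⟩ := hstep
    exact ⟨hgood, by rw [Finset.card_insert_of_notMem he]; omega⟩

theorem GreedyReachable.exists_step (hH : H.IsTree) (hT : ∃ C, IsSingleToSingleCut H T C)
    {F : Finset (Sym2 V)} (hF : GreedyReachable H wH T F) (hq : F.card + 1 < q) :
    ∃ F', GreedyStep H wH T F F' := by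
  classical
  have := Fintype.ofFinite V
  obtain ⟨C, hC⟩ := hT
  have hne : ∀ i, (T i).Nonempty := fun i => ⟨_, hC.2.choose_spec.1 i⟩
  obtain ⟨hgood, -⟩ := hF.isGoodCut hH (by omega) hne
  obtain ⟨e, heC, heF, he⟩ := hgood.exists_insert hH hC hq
  obtain ⟨e₀, he₀, hmin⟩ := Finset.exists_min_image
    (Finset.univ.filter fun e => e ∈ H.edgeSet ∧ e ∉ F ∧ IsGoodCut H T (insert e F)) wH
    ⟨e, by simpa using ⟨hC.1 heC, heF, he⟩⟩
  simp only [Finset.mem_filter, Finset.mem_univ, true_and] at he₀ hmin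
  exact ⟨_, hq, e₀, he₀.1, he₀.2.1, he₀.2.2, fun e' h1 h2 h3 => hmin e' ⟨h1, h2, h3⟩, rfl⟩

theorem exists_isGreedyOutput (hH : H.IsTree) (hT : ∃ C, IsSingleToSingleCut H T C) :
    ∃ F, IsGreedyOutput H wH T F := by
  suffices h : ∀ n, ∀ F, GreedyReachable H wH T F → q ≤ F.card + n →
      ∃ F, IsGreedyOutput H wH T F from h q ∅ .refl (by simp)
  intro n
  induction n with
  | zero => exact fun F hF hq => ⟨F, hF, by omega⟩
  | succ n ih =>
    intro F hF hq
    by_cases hlt : F.card + 1 < q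
    · obtain ⟨F', hF'⟩ := hF.exists_step hH hT hlt
      refine ih F' (hF.tail hF') ?_
      obtain ⟨-, e, -, he, -, -, rfl⟩ := hF'
      rw [Finset.card_insert_of_notMem he]
      omega
    · exact ⟨F, hF, hlt⟩

/-- Every greedy prefix extends to a good cut with `q - 1` edges that is at most as heavy as a given
solution. -/
theorem GreedyReachable.exists_extension_le (hH : H.IsTree) (hw : ∀ e ∈ H.edgeSet, 0 ≤ wH e)
    (hq : 1 ≤ q) {C : Finset (Sym2 V)} (hC : IsSingleToSingleCut H T C) {F : Finset (Sym2 V)}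
    (hF : GreedyReachable H wH T F) :
    ∃ B, F ⊆ B ∧ IsGoodCut H T B ∧ B.card + 1 = q ∧
      edgeSetWeight wH B ≤ edgeSetWeight wH C := by
  have hne : ∀ i, (T i).Nonempty := fun i => ⟨_, hC.2.choose_spec.1 i⟩
  induction hF with
  | refl =>
    obtain ⟨B, -, hBC, hB, hcard⟩ :=
      (isGoodCut_empty hH hq hne).exists_extension hH hC (by simpa using hq)
    rw [Finset.empty_union] at hBC
    exact ⟨B, Finset.empty_subset _, hB, hcard,
      Finset.sum_le_sum_of_subset_of_nonneg hBC fun e he _ => hw e (hC.1 he)⟩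
  | @tail F F' hF hstep ih =>
    obtain ⟨B, hFB, hB, hcard, hle⟩ := ih
    obtain ⟨hlt, e, heH, heF, hgood, hmin, rfl⟩ := hstep
    by_cases heB : e ∈ B
    · exact ⟨B, Finset.insert_subset heB hFB, hB, hcard, hle⟩
    obtain ⟨B', h1, h2, hB', hcard'⟩ := hgood.exists_extension hH
      (hB.isSingleToSingleCut hcard) (by rw [Finset.card_insert_of_notMem heF]; omega)
    rw [Finset.insert_union, Finset.union_eq_right.2 hFB] at h2
    refine ⟨B', h1, hB', hcard', le_trans ?_ hle⟩
    -- `B'` has one element fewer than `B + e`, so it omits exactly one edge `f`, which lies in `B`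
    -- but not in `F`. As a subset of `B`, `F + f` is good, so `f` competed with `e` in the greedy
    -- choice.
    have hsd := Finset.card_sdiff_add_card_eq_card h2
    rw [Finset.card_insert_of_notMem heB] at hsd
    obtain ⟨f, hf⟩ := Finset.card_eq_one.1 (show (insert e B \ B').card = 1 by omega)
    have hf' : f ∈ insert e B \ B' := by rw [hf]; exact Finset.mem_singleton_self f
    obtain ⟨hfB, hfB'⟩ := Finset.mem_sdiff.1 hf'
    have hfe : f ≠ e := by
      rintro rfl
      exact hfB' (h1 (Finset.mem_insert_self _ _))
    have hfB := (Finset.mem_insert.1 hfB).resolve_left hfe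
    have hfF : f ∉ F := fun h => hfB' (h1 (Finset.mem_insert_of_mem h))
    have hef := hmin f (hB.1 hfB) hfF (hB.subset hH (Finset.insert_subset hfB hFB))
    have hsum := Finset.sum_sdiff (f := wH) h2
    rw [hf, Finset.sum_singleton, Finset.sum_insert heB] at hsum
    unfold edgeSetWeight
    linarith

theorem IsGreedyOutput.isApproxSolution (hH : H.IsTree) (hw : ∀ e ∈ H.edgeSet, 0 ≤ wH e)
    (hq : 1 ≤ q) (hne : ∀ i, (T i).Nonempty) {F : Finset (Sym2 V)}
    (hF : IsGreedyOutput H wH T F) : IsApproxSolution (IsSingleToSingleCut H T) wH 1 F := by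
  obtain ⟨hF, hlt⟩ := hF
  obtain ⟨hgood, hle⟩ := hF.isGoodCut hH hq hne
  refine ⟨hgood.isSingleToSingleCut (by omega), fun C hC => ?_⟩
  obtain ⟨B, hFB, -, hcard, hBC⟩ := hF.exists_extension_le hH hw hq hC
  rw [Finset.eq_of_subset_of_card_le hFB (by omega), one_mul]
  exact hBC

end Greedy

/-! ### Cuts given by vertex sets -/

section Cuts

theorem edgeSetWeight_mono {V : Type*} {G : SimpleGraph V} {w : Sym2 V → ℝ}
    (hw : ∀ e ∈ G.edgeSet, 0 ≤ w e) {A B : Finset (Sym2 V)} (hAB : A ⊆ B)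
    (hB : (B : Set (Sym2 V)) ⊆ G.edgeSet) : edgeSetWeight w A ≤ edgeSetWeight w B :=
  Finset.sum_le_sum_of_subset_of_nonneg hAB fun e he _ => hw e (hB he)

variable {V : Type*} [Fintype V] [DecidableEq V] {G : SimpleGraph V} {w : Sym2 V → ℝ}

open Classical in
/-- The edges of `G` with exactly one end in `X`. -/
noncomputable def cutEdges (G : SimpleGraph V) (X : Set V) : Finset (Sym2 V) :=
  Finset.univ.filter fun f => f ∈ G.edgeSet ∧ ∃ u v : V, f = s(u, v) ∧ u ∈ X ∧ v ∉ X

theorem mem_cutEdges {X : Set V} {a b : V} :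
    s(a, b) ∈ cutEdges G X ↔ G.Adj a b ∧ ¬ (a ∈ X ↔ b ∈ X) := by
  simp only [cutEdges, Finset.mem_filter, Finset.mem_univ, true_and, SimpleGraph.mem_edgeSet]
  refine and_congr_right fun _ => ⟨?_, fun h => ?_⟩
  · rintro ⟨u, v, he, hu, hv⟩
    rcases Sym2.eq_iff.1 he with ⟨rfl, rfl⟩ | ⟨rfl, rfl⟩ <;> tauto
  · by_cases ha : a ∈ X
    · exact ⟨a, b, rfl, ha, by tauto⟩
    · exact ⟨b, a, Sym2.eq_swap, by tauto, ha⟩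

theorem cutEdges_subset (X : Set V) : (cutEdges G X : Set (Sym2 V)) ⊆ G.edgeSet := by
  intro e he
  simp only [cutEdges, Finset.coe_filter, Set.mem_ofPred_eq] at he
  exact he.2.1

theorem cutEdges_compl (X : Set V) : cutEdges G Xᶜ = cutEdges G X := by
  ext e
  induction e with | _ a b
  simp only [mem_cutEdges, Set.mem_compl_iff, not_iff_not]

theorem cutEdges_isSeparatingCut {X : Set V} {a b : V} (ha : a ∈ X) (hb : b ∉ X) :
    IsSeparatingCut G a b (cutEdges G X) := by
  refine ⟨cutEdges_subset X, fun h => ?_⟩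
  have := h.apply_eq_of_adj (f := (· ∈ X)) fun x y hxy => by
    rw [SimpleGraph.deleteEdges_adj, Finset.mem_coe, mem_cutEdges] at hxy
    exact propext (by tauto)
  exact hb (this ▸ ha)

/-- The boundary of a component of `G - C` is contained in `C`. -/
theorem cutEdges_reachable_subset (C : Finset (Sym2 V)) (a : V) :
    cutEdges G {v | (G.deleteEdges (C : Set (Sym2 V))).Reachable a v} ⊆ C := by
  intro e he
  induction e with | _ x y
  obtain ⟨hadj, hne⟩ := mem_cutEdges.1 he
  by_contra hC
  have hxy : (G.deleteEdges (C : Set (Sym2 V))).Reachable x y :=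
    SimpleGraph.Adj.reachable (by simpa [hC] using hadj)
  exact hne ⟨fun h => h.trans hxy, fun h => h.trans hxy.symm⟩

theorem edgeSetWeight_cutEdges (X : Set V) [DecidablePred (· ∈ cutEdges G X)] :
    edgeSetWeight w (cutEdges G X) = ∑ e, if e ∈ cutEdges G X then w e else 0 := by
  rw [edgeSetWeight, ← Finset.sum_filter]
  congr 1
  ext e
  simp

/-- The cut function is submodular. -/
theorem edgeSetWeight_cutEdges_inter_add_union (hw : ∀ e ∈ G.edgeSet, 0 ≤ w e) (X Y : Set V) :
    edgeSetWeight w (cutEdges G (X ∩ Y)) + edgeSetWeight w (cutEdges G (X ∪ Y)) ≤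
      edgeSetWeight w (cutEdges G X) + edgeSetWeight w (cutEdges G Y) := by
  classical
  simp only [edgeSetWeight_cutEdges, ← Finset.sum_add_distrib]
  refine Finset.sum_le_sum fun e _ => ?_
  induction e with | _ a b
  simp only [mem_cutEdges, Set.mem_inter_iff, Set.mem_union]
  by_cases hab : G.Adj a b
  · have := hw s(a, b) hab
    by_cases h1 : a ∈ X <;> by_cases h2 : b ∈ X <;> by_cases h3 : a ∈ Y <;> by_cases h4 : b ∈ Y <;>
      simp [*]
  · simp [hab]

/-- Submodularity for `X` and `Yᶜ`, combined with the symmetry of the cut function. -/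
theorem edgeSetWeight_cutEdges_sdiff_add_sdiff (hw : ∀ e ∈ G.edgeSet, 0 ≤ w e) (X Y : Set V) :
    edgeSetWeight w (cutEdges G (X \ Y)) + edgeSetWeight w (cutEdges G (Y \ X)) ≤
      edgeSetWeight w (cutEdges G X) + edgeSetWeight w (cutEdges G Y) := by
  have h := edgeSetWeight_cutEdges_inter_add_union hw X Yᶜ
  rw [cutEdges_compl Y, ← cutEdges_compl (X ∪ Yᶜ), Set.compl_union, compl_compl, Set.inter_comm _ Y]
    at h
  exact h

theorem treeEdgeCut_subset (H : SimpleGraph V) (e : Sym2 V) :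
    (treeEdgeCut G H e : Set (Sym2 V)) ⊆ G.edgeSet := by
  intro f hf
  simp only [treeEdgeCut, Finset.coe_filter, Set.mem_ofPred_eq] at hf
  exact hf.2.1

theorem mem_treeEdgeCut {H : SimpleGraph V} {e : Sym2 V} {a b : V} :
    s(a, b) ∈ treeEdgeCut G H e ↔ G.Adj a b ∧ ¬ (H.deleteEdges {e}).Reachable a b := by
  simp only [treeEdgeCut, Finset.mem_filter, Finset.mem_univ, true_and, SimpleGraph.mem_edgeSet]
  refine and_congr_right fun _ => ⟨?_, fun h => ⟨a, b, rfl, h⟩⟩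
  rintro ⟨u, v, he, h⟩
  rcases Sym2.eq_iff.1 he with ⟨rfl, rfl⟩ | ⟨rfl, rfl⟩
  · exact h
  · exact fun h' => h h'.symm

theorem not_reachable_deleteEdges_treeEdgeCut {H : SimpleGraph V} {e : Sym2 V} {x y : V}
    (h : ¬ (H.deleteEdges {e}).Reachable x y) :
    ¬ (G.deleteEdges (treeEdgeCut G H e : Set (Sym2 V))).Reachable x y := by
  intro hr
  have := hr.apply_eq_of_adj (f := (H.deleteEdges {e}).Reachable x) fun a b hab => by
    rw [SimpleGraph.deleteEdges_adj, Finset.mem_coe, mem_treeEdgeCut] at hab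
    have hab : (H.deleteEdges {e}).Reachable a b := by tauto
    exact propext ⟨fun h => h.trans hab, fun h => h.trans hab.symm⟩
  exact h (this ▸ .rfl)

theorem treeEdgeCut_eq_cutEdges {H : SimpleGraph V} {e : Sym2 V} {X : Set V}
    (h : ∀ a b, (H.deleteEdges {e}).Reachable a b ↔ (a ∈ X ↔ b ∈ X)) :
    treeEdgeCut G H e = cutEdges G X := by
  ext f
  induction f with | _ a b
  rw [mem_treeEdgeCut, mem_cutEdges, h]

/-- A tree whose edges all correspond to minimum cuts between their own ends is a Gomory-Hu tree. -/
theorem isGomoryHuTree_of_forall_adj (hw : ∀ e ∈ G.edgeSet, 0 ≤ w e) {H : SimpleGraph V}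
    (hH : H.IsTree)
    (hmin : ∀ a b, H.Adj a b → ∀ Z : Set V, a ∈ Z → b ∉ Z →
      edgeSetWeight w (treeEdgeCut G H s(a, b)) ≤ edgeSetWeight w (cutEdges G Z)) :
    IsGomoryHuTree G w H fun e => edgeSetWeight w (treeEdgeCut G H e) := by
  refine ⟨hH, fun s t p _ hp e he hle => ⟨⟨⟨treeEdgeCut_subset H e,
    not_reachable_deleteEdges_treeEdgeCut (hH.2.not_reachable_deleteEdges_of_mem_edges hp he)⟩,
    fun C hC => ?_⟩, rfl⟩⟩
  -- The tree path must leave the `s`-side of `C` along some edge. The boundary of that side is a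
  -- cut between the ends of this edge, and `e` is no heavier than it.
  obtain ⟨d, hd, hd1, hd2⟩ := p.exists_boundary_dart
    {v | (G.deleteEdges (C : Set (Sym2 V))).Reachable s v} SimpleGraph.Reachable.rfl hC.2
  rw [one_mul]
  calc _ ≤ edgeSetWeight w (treeEdgeCut G H d.edge) :=
        hle _ (List.mem_map_of_mem hd)
    _ ≤ _ := hmin d.fst d.snd d.adj _ hd1 hd2
    _ ≤ _ := edgeSetWeight_mono hw (cutEdges_reachable_subset C s) hC.1

theorem IsGomoryHuTree.le_cutEdges {H : SimpleGraph V} {wH : Sym2 V → ℝ}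
    (h : IsGomoryHuTree G w H wH) {a b : V} (hab : H.Adj a b) {X : Set V} (ha : a ∈ X)
    (hb : b ∉ X) : wH s(a, b) ≤ edgeSetWeight w (cutEdges G X) := by
  obtain ⟨⟨-, hmin⟩, heq⟩ := h.minCut a b hab.toWalk hab.ne (by simp [hab.ne]) s(a, b) (by simp)
    (by simp)
  rw [heq, ← one_mul (edgeSetWeight w (cutEdges G X))]
  exact hmin _ (cutEdges_isSeparatingCut ha hb)

theorem IsGomoryHuTree.eq_weight {H : SimpleGraph V} {wH : Sym2 V → ℝ}
    (h : IsGomoryHuTree G w H wH) {e : Sym2 V} (he : e ∈ H.edgeSet) :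
    wH e = edgeSetWeight w (treeEdgeCut G H e) := by
  induction e with | _ a b
  have hab : H.Adj a b := he
  exact (h.minCut a b hab.toWalk hab.ne (by simp [hab.ne]) s(a, b) (by simp) (by simp)).2

theorem IsGomoryHuTree.nonneg (hw : ∀ e ∈ G.edgeSet, 0 ≤ w e) {H : SimpleGraph V} {wH : Sym2 V → ℝ}
    (h : IsGomoryHuTree G w H wH) {e : Sym2 V} (he : e ∈ H.edgeSet) : 0 ≤ wH e := by
  rw [h.eq_weight he]
  exact Finset.sum_nonneg fun f hf => hw f (treeEdgeCut_subset H e hf)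

end Cuts

/-! ### The approximation ratio -/

section Rooted

variable {V : Type*} {H : SimpleGraph V}

/-- A tree rooted at `z`: the parent function and the depth. -/
theorem SimpleGraph.IsTree.exists_parent (hH : H.IsTree) (z : V) :
    ∃ (par : V → V) (depth : V → ℕ),
      (∀ u, u ≠ z → H.Adj u (par u) ∧ depth u = depth (par u) + 1) ∧
      ∀ a b, H.Adj a b → (a ≠ z ∧ par a = b) ∨ (b ≠ z ∧ par b = a) := by
  choose p hp using fun u => hH.1.exists_isPath u z
  have huniq : ∀ u (r : H.Walk u z), r.IsPath → p u = r := fun u r hr =>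
    congrArg Subtype.val ((hH.2.subsingleton_path u z).elim ⟨p u, hp u⟩ ⟨r, hr⟩)
  have hpar : ∀ a b, (h : H.Adj a b) → a ∉ (p b).support → a ≠ z ∧ (p a).snd = b := by
    intro a b h ha
    refine ⟨?_, ?_⟩
    · rintro rfl
      exact ha (p b).end_mem_support
    · rw [huniq a (.cons h (p b)) ((hp b).cons ha)]
      simp
  refine ⟨fun u => (p u).snd, fun u => (p u).length, fun u hu => ?_, fun a b hab => ?_⟩
  · cases hpu : p u with
    | nil => exact absurd rfl hu
    | @cons _ v _ h r =>
      have hr : r.IsPath := by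
        have := hp u
        rw [hpu] at this
        exact this.of_cons
      have hs : (p u).snd = v := by rw [hpu, SimpleGraph.Walk.snd_cons r h]
      show H.Adj u (p u).snd ∧ (p u).length = (p (p u).snd).length + 1
      rw [hs, huniq v r hr, hpu]
      exact ⟨h, SimpleGraph.Walk.length_cons h r⟩
  · by_cases ha : a ∈ (p b).support
    · refine Or.inr ⟨?_, ?_⟩
      · rintro rfl
        rw [huniq b .nil .nil] at ha
        simp only [SimpleGraph.Walk.support_nil, List.mem_singleton] at ha
        exact hab.ne ha
      · exact (hH.2.eq_snd_of_adj_start (hp b) hab.symm ha).symm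
    · exact Or.inl (hpar a b hab ha)

/-- The first element of `S` on the way to the root. -/
theorem exists_top {z : V} {par : V → V} {depth : V → ℕ}
    (hdepth : ∀ u, u ≠ z → depth u = depth (par u) + 1) {S : Set V} (hz : z ∈ S) :
    ∃ top : V → V, (∀ x ∈ S, top x = x) ∧ ∀ x ∉ S, top x = top (par x) := by
  classical
  -- The iterated map stands still on `S`, which contains the root, so `depth x` iterations suffice.
  refine ⟨fun x => (fun y => if y ∈ S then y else par y)^[depth x] x, fun x hx => ?_, fun x hx => ?_⟩
  · exact Function.iterate_fixed (by simp [hx]) _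
  · have hxz : x ≠ z := fun h => hx (h ▸ hz)
    simp only [hdepth x hxz, Function.iterate_succ_apply, if_neg hx]

/-- `u` is the last vertex before the climb from `x` first leaves `X`. A climb that stops in `S ∋ u`
stops at `u` or earlier, hence still in `X`. -/
theorem exists_exit {z : V} {par : V → V} {depth : V → ℕ}
    (hdepth : ∀ u, u ≠ z → depth u = depth (par u) + 1) {X : Set V} (hz : z ∉ X) {x : V}
    (hx : x ∈ X) :
    ∃ u ∈ X, par u ∉ X ∧ ∀ (S : Set V) (top : V → V), u ∈ S → (∀ y ∈ S, top y = y) →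
      (∀ y ∉ S, top y = top (par y)) → top x ∈ X := by
  obtain ⟨n, hn⟩ : ∃ n, depth x = n := ⟨_, rfl⟩
  induction n generalizing x with
  | zero =>
    have := hdepth x (fun h => hz (h ▸ hx))
    omega
  | succ n ih =>
    by_cases hp : par x ∈ X
    · have := hdepth x (fun h => hz (h ▸ hx))
      obtain ⟨u, hu, hpu, h⟩ := ih hp (by omega)
      refine ⟨u, hu, hpu, fun S top huS h1 h2 => ?_⟩
      by_cases hxS : x ∈ S
      · rwa [h1 x hxS]
      · rw [h2 x hxS]
        exact h S top huS h1 h2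
    · exact ⟨x, hx, hp, fun S top huS h1 _ => by rwa [h1 x huS]⟩

/-- Given disjoint vertex sets `X i` with representatives `t i`, the representatives can be
separated in a tree by choosing for every `i ≠ i₀` one edge leaving `X i`. -/
theorem SimpleGraph.IsTree.exists_separating_edges (hH : H.IsTree) {ι : Type*}
    {X : ι → Set V} (hX : ∀ i j v, v ∈ X i → v ∈ X j → i = j) {t : ι → V} (ht : ∀ i, t i ∈ X i)
    (i₀ : ι) :
    ∃ a b : ι → V, (∀ i, i ≠ i₀ → H.Adj (a i) (b i) ∧ a i ∈ X i ∧ b i ∉ X i) ∧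
      ∀ i j, i ≠ j →
        ¬ (H.deleteEdges {e | ∃ k, k ≠ i₀ ∧ e = s(a k, b k)}).Reachable (t i) (t j) := by
  obtain ⟨par, depth, hpar, hadj⟩ := hH.exists_parent (t i₀)
  have hdepth := fun u hu => (hpar u hu).2
  have hz : ∀ i, i ≠ i₀ → t i₀ ∉ X i := fun i hi h => hi (hX i i₀ _ h (ht i₀))
  have hex : ∀ i, ∃ u, i ≠ i₀ → u ∈ X i ∧ par u ∉ X i ∧ ∀ (S : Set V) (top : V → V), u ∈ S →
      (∀ y ∈ S, top y = y) → (∀ y ∉ S, top y = top (par y)) → top (t i) ∈ X i := by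
    intro i
    by_cases hi : i = i₀
    · exact ⟨t i, fun h => absurd hi h⟩
    · obtain ⟨u, h⟩ := exists_exit hdepth (hz i hi) (ht i)
      exact ⟨u, fun _ => h⟩
  choose u hu using hex
  refine ⟨u, fun i => par (u i), fun i hi => ⟨(hpar _ ?_).1, (hu i hi).1, (hu i hi).2.1⟩, ?_⟩
  · intro h
    exact hz i hi (h ▸ (hu i hi).1)
  intro i j hij hr
  -- `S` consists of the root and the lower ends of the chosen edges. Hence `top` is constant along
  -- all other edges, while it sends each `t k` into `X k`.
  set S : Set V := {v | v = t i₀ ∨ ∃ k, k ≠ i₀ ∧ v = u k} with hS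
  obtain ⟨top, htop1, htop2⟩ := exists_top hdepth (S := S) (Or.inl rfl)
  have hmem : ∀ k, top (t k) ∈ X k := by
    intro k
    by_cases hk : k = i₀
    · subst hk
      rw [htop1 _ (Or.inl rfl)]
      exact ht k
    · exact (hu k hk).2.2 S top (Or.inr ⟨k, hk, rfl⟩) htop1 htop2
  have hstep : ∀ a b, a ≠ t i₀ → par a = b →
      s(a, b) ∉ {e | ∃ k, k ≠ i₀ ∧ e = s(u k, par (u k))} → top a = top b := by
    rintro a _ ha rfl hab
    refine htop2 a ?_
    rintro (h | ⟨k, hk, rfl⟩)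
    · exact ha h
    · exact hab ⟨k, hk, rfl⟩
  refine hij (hX i j (top (t i)) (hmem i) ?_)
  rw [hr.apply_eq_of_adj (f := top) fun a b hab => ?_]
  · exact hmem j
  rw [SimpleGraph.deleteEdges_adj] at hab
  rcases hadj a b hab.1 with ⟨h1, h2⟩ | ⟨h1, h2⟩
  · exact hstep a b h1 h2 hab.2
  · exact (hstep b a h1 h2 (by rw [Sym2.eq_swap]; exact hab.2)).symm

end Rooted

/-! ### Boundary charging and the factor `2 - 2 / q` -/

section Ratio

theorem edgeSetWeight_biUnion_le {V α : Type*} [DecidableEq V] {G : SimpleGraph V} {w : Sym2 V → ℝ}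
    (hw : ∀ e ∈ G.edgeSet, 0 ≤ w e) (F : Finset α) {U : α → Finset (Sym2 V)}
    (hU : ∀ a, (U a : Set (Sym2 V)) ⊆ G.edgeSet) :
    edgeSetWeight w (F.biUnion U) ≤ ∑ a ∈ F, edgeSetWeight w (U a) := by
  classical
  induction F using Finset.induction_on with
  | empty => simp [edgeSetWeight]
  | insert a F ha ih =>
    rw [Finset.biUnion_insert, Finset.sum_insert ha]
    have h1 := Finset.sum_union_inter (f := w) (s₁ := U a) (s₂ := F.biUnion U)
    have h2 : 0 ≤ ∑ e ∈ U a ∩ F.biUnion U, w e :=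
      Finset.sum_nonneg fun e he => hw e (hU a (Finset.mem_inter.1 he).1)
    simp only [edgeSetWeight] at ih ⊢
    linarith

variable {V : Type*} [Fintype V] [DecidableEq V] {G : SimpleGraph V} {w : Sym2 V → ℝ}

/-- Every edge lies in the boundaries of at most two of the disjoint sets `X i`. -/
theorem sum_edgeSetWeight_cutEdges_le {ι : Type*} [Fintype ι] {X : ι → Set V}
    (hX : ∀ i j v, v ∈ X i → v ∈ X j → i = j) {C : Finset (Sym2 V)}
    (hC : ∀ e ∈ C, 0 ≤ w e) (hXC : ∀ i, cutEdges G (X i) ⊆ C) :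
    ∑ i, edgeSetWeight w (cutEdges G (X i)) ≤ 2 * edgeSetWeight w C := by
  classical
  have h1 : ∀ i, edgeSetWeight w (cutEdges G (X i)) =
      ∑ e ∈ C, if e ∈ cutEdges G (X i) then w e else 0 := by
    intro i
    rw [← Finset.sum_filter, Finset.filter_mem_eq_inter, Finset.inter_eq_right.2 (hXC i)]
    rfl
  simp only [h1]
  rw [Finset.sum_comm, edgeSetWeight, Finset.mul_sum]
  refine Finset.sum_le_sum fun e he => ?_
  rw [← Finset.sum_filter, Finset.sum_const, nsmul_eq_mul]
  refine mul_le_mul_of_nonneg_right ?_ (hC e he)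
  induction e with | _ a b
  have hone : ∀ v, (Finset.univ.filter fun i => v ∈ X i).card ≤ 1 := fun v =>
    Finset.card_le_one.2 fun i hi j hj => hX i j v (by simpa using hi) (by simpa using hj)
  have hsub : (Finset.univ.filter fun i => s(a, b) ∈ cutEdges G (X i)) ⊆
      (Finset.univ.filter fun i => a ∈ X i) ∪ (Finset.univ.filter fun i => b ∈ X i) := by
    intro i hi
    simp only [Finset.mem_filter, Finset.mem_univ, true_and, mem_cutEdges, Finset.mem_union] at hi ⊢
    tauto
  have := (Finset.card_le_card hsub).trans (Finset.card_union_le _ _)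
  have := hone a
  have := hone b
  exact_mod_cast (by omega : (Finset.univ.filter fun i => s(a, b) ∈ cutEdges G (X i)).card ≤ 2)

/-- A Gomory-Hu tree has a solution of Single-to-Single of weight at most `2 - 2 / q` times that of
a given solution on `G`. -/
theorem IsGomoryHuTree.exists_isSingleToSingleCut_le (hw : ∀ e ∈ G.edgeSet, 0 ≤ w e)
    {H : SimpleGraph V} {wH : Sym2 V → ℝ} (hGH : IsGomoryHuTree G w H wH) {q : ℕ} (hq : 1 ≤ q)
    {T : Fin q → Set V} {C : Finset (Sym2 V)} (hC : IsSingleToSingleCut G T C) :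
    ∃ F, IsSingleToSingleCut H T F ∧
      edgeSetWeight wH F ≤ (2 - 2 / (q : ℝ)) * edgeSetWeight w C := by
  classical
  obtain ⟨hCG, t, htT, hsep⟩ := hC
  set X : Fin q → Set V := fun i => {v | (G.deleteEdges (C : Set (Sym2 V))).Reachable (t i) v}
    with hXdef
  have hX : ∀ i j v, v ∈ X i → v ∈ X j → i = j := by
    intro i j v hi hj
    by_contra hij
    exact hsep i j hij (SimpleGraph.Reachable.trans hi (SimpleGraph.Reachable.symm hj))
  set c : Fin q → ℝ := fun i => edgeSetWeight w (cutEdges G (X i)) with hc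
  -- The heaviest boundary carries at least a `1 / q` share of the sum; not paying for it turns `2`
  -- into `2 - 2 / q`.
  obtain ⟨i₀, -, hmax⟩ := Finset.exists_max_image Finset.univ c ⟨⟨0, hq⟩, Finset.mem_univ _⟩
  have hsum : ∑ i, c i ≤ 2 * edgeSetWeight w C :=
    sum_edgeSetWeight_cutEdges_le hX (fun e he => hw e (hCG he))
      fun i => cutEdges_reachable_subset C (t i)
  obtain ⟨a, b, hab, hnr⟩ := hGH.isTree.exists_separating_edges hX
    (t := t) (fun i => SimpleGraph.Reachable.rfl) i₀
  have hF : (((Finset.univ.erase i₀).image fun i => s(a i, b i) : Finset (Sym2 V)) : Set (Sym2 V)) =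
      {e | ∃ k, k ≠ i₀ ∧ e = s(a k, b k)} := by
    ext e
    simp [eq_comm]
  refine ⟨(Finset.univ.erase i₀).image fun i => s(a i, b i), ⟨?_, t, htT, ?_⟩, ?_⟩
  · rw [hF]
    rintro _ ⟨k, hk, rfl⟩
    exact (hab k hk).1
  · rw [hF]
    exact hnr
  have hle : edgeSetWeight wH ((Finset.univ.erase i₀).image fun i => s(a i, b i)) ≤
      ∑ i ∈ Finset.univ.erase i₀, c i := by
    calc _ ≤ ∑ i ∈ Finset.univ.erase i₀, wH s(a i, b i) := by
          refine Finset.sum_image_le_of_nonneg fun e he => ?_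
          obtain ⟨i, hi, rfl⟩ := Finset.mem_image.1 he
          exact hGH.nonneg hw (hab i (Finset.ne_of_mem_erase hi)).1
      _ ≤ _ := Finset.sum_le_sum fun i hi => by
          obtain ⟨h1, h2, h3⟩ := hab i (Finset.ne_of_mem_erase hi)
          exact hGH.le_cutEdges h1 h2 h3
  have hq0 : (0 : ℝ) < q := by exact_mod_cast hq
  have hmaxsum : ∑ i, c i ≤ q * c i₀ := by
    calc ∑ i, c i ≤ ∑ _i : Fin q, c i₀ := Finset.sum_le_sum fun i hi => hmax i hi
      _ = q * c i₀ := by simp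
  have herase := Finset.add_sum_erase Finset.univ c (Finset.mem_univ i₀)
  have hdiv : (∑ i, c i) / q ≤ c i₀ := by
    rw [div_le_iff₀ hq0, mul_comm]
    exact hmaxsum
  have hone : (1 : ℝ) / q ≤ 1 := by
    rw [div_le_one hq0]
    exact_mod_cast hq
  calc _ ≤ ∑ i ∈ Finset.univ.erase i₀, c i := hle
    _ ≤ (1 - 1 / (q : ℝ)) * ∑ i, c i := by
        have : (1 - 1 / (q : ℝ)) * ∑ i, c i = (∑ i, c i) - (∑ i, c i) / q := by ring
        linarith
    _ ≤ (1 - 1 / (q : ℝ)) * (2 * edgeSetWeight w C) :=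
        mul_le_mul_of_nonneg_left hsum (by linarith)
    _ = _ := by ring

theorem IsGomoryHuTree.isSingleToSingleCut_biUnion {H : SimpleGraph V} {wH : Sym2 V → ℝ}
    (hGH : IsGomoryHuTree G w H wH) {q : ℕ} {T : Fin q → Set V} {F : Finset (Sym2 V)}
    (hF : IsSingleToSingleCut H T F) : IsSingleToSingleCut G T (F.biUnion (treeEdgeCut G H)) := by
  obtain ⟨-, t, htT, hsep⟩ := hF
  refine ⟨?_, t, htT, fun i j hij hr => ?_⟩
  · intro f hf
    obtain ⟨e, -, he⟩ := Finset.mem_biUnion.1 (Finset.mem_coe.1 hf)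
    exact treeEdgeCut_subset H e he
  · obtain ⟨e, he, -, hnr⟩ := hGH.isTree.2.exists_not_reachable_deleteEdges_singleton
      (hGH.isTree.1.preconnected _ _) (hsep i j hij)
    refine not_reachable_deleteEdges_treeEdgeCut hnr (hr.mono (SimpleGraph.deleteEdges_anti ?_))
    exact_mod_cast Finset.subset_biUnion_of_mem (treeEdgeCut G H) he

/-- The approximation algorithm returns a solution of weight at most `2 - 2 / q` times the
optimum. -/
theorem IsGomoryHuGreedyOutput.isApproxSolution (hw : ∀ e ∈ G.edgeSet, 0 ≤ w e) {q : ℕ}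
    (hq : 1 ≤ q) {T : Fin q → Set V} (hne : ∀ i, (T i).Nonempty) {D : Finset (Sym2 V)}
    (hD : IsGomoryHuGreedyOutput G w T D) :
    IsApproxSolution (IsSingleToSingleCut G T) w (2 - 2 / (q : ℝ)) D := by
  obtain ⟨H, wH, F, hGH, hF, rfl⟩ := hD
  obtain ⟨hfeas, hopt⟩ := hF.isApproxSolution hGH.isTree (fun e he => hGH.nonneg hw he) hq hne
  refine ⟨hGH.isSingleToSingleCut_biUnion hfeas, fun C hC => ?_⟩
  obtain ⟨F', hF', hle⟩ := hGH.exists_isSingleToSingleCut_le hw hq hC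
  calc _ ≤ ∑ e ∈ F, edgeSetWeight w (treeEdgeCut G H e) :=
        edgeSetWeight_biUnion_le hw F fun e => treeEdgeCut_subset H e
    _ = edgeSetWeight wH F :=
        Finset.sum_congr rfl fun e he => (hGH.eq_weight (hfeas.1 he)).symm
    _ ≤ 1 * edgeSetWeight wH F' := hopt F' hF'
    _ ≤ _ := by rwa [one_mul]

end Ratio

/-! ### Existence of Gomory-Hu trees -/

section TreeDirection

variable {V : Type*}

/-- `d u z` is the neighbour of `u` on the way to `z` in a tree (and `d u u = u`). -/
structure IsTreeDirection (d : V → V → V) : Prop where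
  self : ∀ u, d u u = u
  ne : ∀ u z, z ≠ u → d u z ≠ u
  idem : ∀ u z, d u (d u z) = d u z
  -- The two branches across an edge are complementary.
  side : ∀ u y, u ≠ y → d u y = y → ∀ z, d u z = y ↔ d y z ≠ u

/-- The graph of a direction map. -/
def directionGraph (d : V → V → V) : SimpleGraph V where
  Adj u y := u ≠ y ∧ d u y = y ∧ d y u = u
  symm := ⟨fun _ _ h => ⟨h.1.symm, h.2.2, h.2.1⟩⟩
  loopless := ⟨fun _ h => h.1 rfl⟩

namespace IsTreeDirection

variable {d : V → V → V}

theorem symm (hd : IsTreeDirection d) {u y : V} (hne : u ≠ y) (h : d u y = y) : d y u = u := by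
  by_contra h'
  have := (hd.side u y hne h u).2 h'
  rw [hd.self] at this
  exact hne this

theorem adj_apply (hd : IsTreeDirection d) {u z : V} (h : z ≠ u) :
    (directionGraph d).Adj u (d u z) :=
  ⟨(hd.ne u z h).symm, hd.idem u z, hd.symm (hd.ne u z h).symm (hd.idem u z)⟩

/-- One step towards `z` shrinks the branch containing `z`, which loses at least `d u z`. Its size
is the induction measure below. -/
theorem ssubset (hd : IsTreeDirection d) {u z : V} (hu : z ≠ u) (hz : z ≠ d u z) :
    {x | d (d u z) x = d (d u z) z} ⊂ {x | d u x = d u z} := by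
  have hside := hd.side u (d u z) (hd.ne u z hu).symm (hd.idem u z)
  refine (Set.ssubset_iff_of_subset fun x hx => ?_).2 ⟨d u z, hd.idem u z, fun h => ?_⟩
  · refine (hside x).2 ?_
    rw [show d (d u z) x = d (d u z) z from hx]
    exact (hside z).1 rfl
  · have h : d (d u z) (d u z) = d (d u z) z := h
    rw [hd.self] at h
    exact hd.ne _ z hz h.symm

/-- If `a` and `b` lay in different branches at `u`, they would also do so at `d u a`, where the
branch of `a` is smaller. -/
theorem apply_eq_of_adj [Finite V] (hd : IsTreeDirection d) {a b : V}
    (hab : (directionGraph d).Adj a b) (u : V) (ha : u ≠ a) (hb : u ≠ b) : d u a = d u b := by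
  obtain ⟨n, hn⟩ : ∃ n, {x | d u x = d u a}.ncard = n := ⟨_, rfl⟩
  induction n using Nat.strong_induction_on generalizing u with
  | _ n ih =>
    subst hn
    by_contra hne
    have hside := hd.side u (d u a) (hd.ne u a ha.symm).symm (hd.idem u a)
    have hyb : d (d u a) b = u := by
      by_contra h
      exact hne ((hside b).2 h).symm
    have hya : d (d u a) a ≠ u := (hside a).1 rfl
    have h1 : a ≠ d u a := by
      intro h
      rw [← h, hab.2.1] at hyb
      exact hb hyb.symm
    have h2 : d u a ≠ b := by
      intro h
      apply hne
      rw [← h, hd.idem]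
    have := ih _ (Set.ncard_lt_ncard (hd.ssubset ha.symm h1)) (d u a) h1.symm h2 rfl
    exact hya (this.trans hyb)

theorem reachable [Finite V] (hd : IsTreeDirection d) (u z : V) :
    (directionGraph d).Reachable u z := by
  obtain ⟨n, hn⟩ : ∃ n, {x | d u x = d u z}.ncard = n := ⟨_, rfl⟩
  induction n using Nat.strong_induction_on generalizing u with
  | _ n ih =>
    subst hn
    by_cases hu : z = u
    · rw [hu]
    have hadj := (hd.adj_apply hu).reachable
    by_cases hz : z = d u z
    · rwa [← hz] at hadj
    · exact hadj.trans (ih _ (Set.ncard_lt_ncard (hd.ssubset hu hz)) _ rfl)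

theorem reachable_deleteEdges_iff [Finite V] (hd : IsTreeDirection d) {u y : V} (hne : u ≠ y)
    (huy : d u y = y) (a b : V) :
    ((directionGraph d).deleteEdges {s(u, y)}).Reachable a b ↔ (d u a = y ↔ d u b = y) := by
  have hself := hd.self u
  have hforward : ∀ a b, ((directionGraph d).deleteEdges {s(u, y)}).Reachable a b →
      (d u a = y) = (d u b = y) := by
    intro a b h
    refine h.apply_eq_of_adj (f := fun x => d u x = y) fun a b hab => ?_
    rw [SimpleGraph.deleteEdges_adj, Set.mem_singleton_iff] at hab
    obtain ⟨hab, he⟩ := hab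
    have hab' := hab
    obtain ⟨-, h1, h2⟩ := hab'
    by_cases ha : u = a
    · subst ha
      have hb : b ≠ y := fun h => he (by rw [h])
      simp [hself, h1, hne, hb]
    by_cases hb : u = b
    · subst hb
      have ha : a ≠ y := fun h => he (by rw [h, Sym2.eq_swap])
      simp [hself, h2, hne, ha]
    · simp only [hd.apply_eq_of_adj hab u ha hb]
  refine ⟨fun h => iff_of_eq (hforward a b h), fun h => ?_⟩
  rcases (hd.reachable a b).deleteEdges_or u y with hr | ⟨h1, h2⟩ | ⟨h1, h2⟩
  · exact hr
  · have h1 := iff_of_eq (hforward _ _ h1)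
    have h2 := iff_of_eq (hforward _ _ h2)
    rw [hself] at h1
    tauto
  · have h1 := iff_of_eq (hforward _ _ h1)
    have h2 := iff_of_eq (hforward _ _ h2)
    rw [hself] at h2
    tauto

theorem isTree [Finite V] [Nonempty V] (hd : IsTreeDirection d) : (directionGraph d).IsTree := by
  refine ⟨⟨fun u z => hd.reachable u z⟩, SimpleGraph.isAcyclic_iff_forall_adj_isBridge.2 ?_⟩
  intro u y huy
  rw [SimpleGraph.isBridge_iff, hd.reachable_deleteEdges_iff huy.1 huy.2.1, hd.self]
  have := huy.1
  have := huy.2.1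
  tauto

end IsTreeDirection

/-- The star with centre `r`. -/
theorem isTreeDirection_star [DecidableEq V] (r : V) :
    IsTreeDirection fun u z => if u = r then z else if z = u then u else r where
  self := by grind
  ne := by grind
  idem := by grind
  side := by grind

open Classical in
/-- Split `r` along `X`, where `v` is a leaf at `r`: the neighbours of `r` in `X` become neighbours of
`v`. -/
noncomputable def splitDirection (d : V → V → V) (r v : V) (X : Set V) (u z : V) : V :=
  if u = r then (if z ∈ X then v else d r z)
  else if u = v then (if z = v then v else if z ∈ X then d r z else r)
  else if d u z = r ∧ u ∈ X then v else d u z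

/-- `hX` says that `X` is a union of branches at `r`, so whole branches are moved and the directions
inside them stay valid. -/
theorem IsTreeDirection.split {d : V → V → V} (hd : IsTreeDirection d) {r v : V} {X : Set V}
    (hv : v ∈ X) (hr : r ∉ X) (hleaf : ∀ z, z ≠ v → d v z = r)
    (hX : ∀ z, z ∈ X ↔ d r z ∈ X) : IsTreeDirection (splitDirection d r v X) := by
  have hrv : r ≠ v := fun h => hr (h ▸ hv)
  obtain ⟨hself, hne, hidem, hside⟩ := id hd
  have hsymm : ∀ u y, u ≠ y → d u y = y → d y u = u := fun u y => hd.symm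
  have hvr : d v r = r := hleaf r hrv
  have hrv' : d r v = v := hsymm v r hrv.symm hvr
  have hrz : ∀ z, d r z = v → z = v := by
    intro z hz
    by_contra h
    exact (hside r v hrv hrv' z).1 hz (hleaf z h)
  have hyv : ∀ y z, y ≠ v → d y z = v → y = r := by
    intro y z hy hz
    have h1 : d y v = v := by rw [← hz, hidem, hz]
    have h2 := hsymm y v hy h1
    rw [hleaf y hy] at h2
    exact h2.symm
  refine ⟨?_, ?_, ?_, ?_⟩
  · intro u
    unfold splitDirection
    grind
  · intro u z h
    unfold splitDirection
    grind
  · intro u z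
    unfold splitDirection
    grind
  · intro u y huy h z
    -- The case analysis needs the axioms only at `r`, `v`, `u`, `y`, `z`; these instances replace
    -- the quantified hypotheses.
    have h1 := fun hy hd => hside r y hy hd z
    have h2 := fun hu hd => hside u r hu hd z
    have h3 := fun hd => hside u y huy hd z
    have h4 := fun hu hd => hside r u hu hd z
    have h5 := hne r z
    have h6 := hne r y
    have h7 := hyv u z
    have h8 := hyv y z
    have h9 := hyv u y
    have h10 := hsymm u r
    have h11 := hsymm r u
    have h12 := hsymm r y
    have h13 := hX z
    have h14 := hX y
    have h15 := hX u
    have h16 := hrz z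
    have h17 := hrz y
    have h18 := hleaf z
    have h19 := hleaf y
    have h20 := hsymm u y huy
    have h21 := hself v
    have h22 := hself r
    have h23 := hidem u y
    have h24 := hidem r y
    have h25 := hne u y
    clear hd hside hne hidem hyv hsymm hself hX hrz hleaf
    unfold splitDirection at h ⊢
    grind

end TreeDirection

/-! ### Uncrossing and the growth of the cut tree -/

section GomoryHu

variable {V : Type*}

/-- The cut side of a minimum `r`-`v` cut can be chosen as a union of branches at `r`, for any set `N`
of neighbours of `r` whose branches are minimum cuts themselves. -/
theorem exists_minCut_uncrossed [Finite V] {c : Set V → ℝ}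
    (hsub : ∀ X Y, c (X ∩ Y) + c (X ∪ Y) ≤ c X + c Y)
    (hsdiff : ∀ X Y, c (X \ Y) + c (Y \ X) ≤ c X + c Y) {f : V → V} {r v : V} (hrv : r ≠ v)
    (N : Finset V) (hfy : ∀ y ∈ N, f y = y) (hfr : ∀ y ∈ N, f r ≠ y) (hfv : ∀ y ∈ N, f v ≠ y)
    (hmin : ∀ y ∈ N, ∀ Z : Set V, y ∈ Z → r ∉ Z → c {z | f z = y} ≤ c Z) :
    ∃ X : Set V, v ∈ X ∧ r ∉ X ∧ (∀ Z : Set V, v ∈ Z → r ∉ Z → c X ≤ c Z) ∧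
      ∀ y ∈ N, ∀ z, f z = y → (z ∈ X ↔ y ∈ X) := by
  classical
  induction N using Finset.induction_on with
  | empty =>
    obtain ⟨X, ⟨hX1, hX2⟩, hX⟩ := (Set.toFinite {Z : Set V | v ∈ Z ∧ r ∉ Z}).exists_minimalFor c _
      ⟨{v}, rfl, hrv⟩
    refine ⟨X, hX1, hX2, fun Z h1 h2 => ?_, by simp⟩
    rcases le_total (c X) (c Z) with h | h
    · exact h
    · exact hX ⟨h1, h2⟩ h
  | insert y N hy ih =>
    simp only [Finset.forall_mem_insert] at hfy hfr hfv hmin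
    obtain ⟨X, hvX, hrX, hX, hN⟩ := ih hfy.2 hfr.2 hfv.2 hmin.2
    set S : Set V := {z | f z = y} with hS
    have hmemS : ∀ z, z ∈ S ↔ f z = y := fun z => Iff.rfl
    have hyS : y ∈ S := hfy.1
    have hrS : r ∉ S := hfr.1
    have hvS : v ∉ S := hfv.1
    have hNS : ∀ y' ∈ N, ∀ z, f z = y' → z ∉ S ∧ y' ∉ S := by
      intro y' hy' z hz
      have hne : y' ≠ y := fun h => hy (h ▸ hy')
      rw [hmemS, hmemS, hz, hfy.2 y' hy']
      exact ⟨hne, hne⟩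
    -- Absorb the branch `S` if `y ∈ X`, remove it otherwise. As `S` is a minimum cut between `y`
    -- and `r`, neither `X ∩ S` nor, respectively, `S \ X` is lighter, so (posi)modularity keeps the
    -- new set minimum.
    by_cases hyX : y ∈ X
    · refine ⟨X ∪ S, Or.inl hvX, fun h => h.elim hrX hrS, fun Z h1 h2 => ?_, ?_⟩
      · have h3 := hsub X S
        have h4 := hmin.1 (X ∩ S) ⟨hyX, hyS⟩ fun h => hrX h.1
        have h5 := hX Z h1 h2
        linarith
      · rw [Finset.forall_mem_insert]
        refine ⟨fun z hz => ⟨fun _ => Or.inr hyS, fun _ => Or.inr hz⟩, fun y' hy' z hz => ?_⟩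
        obtain ⟨h1, h2⟩ := hNS y' hy' z hz
        simp only [Set.mem_union, h1, h2, or_false]
        exact hN y' hy' z hz
    · refine ⟨X \ S, ⟨hvX, hvS⟩, fun h => hrX h.1, fun Z h1 h2 => ?_, ?_⟩
      · have h3 := hsdiff X S
        have h4 := hmin.1 (S \ X) ⟨hyS, hyX⟩ fun h => hrS h.1
        have h5 := hX Z h1 h2
        linarith
      · rw [Finset.forall_mem_insert]
        refine ⟨fun z hz => ⟨fun h => absurd hz h.2, fun h => absurd hyS h.2⟩, fun y' hy' z hz => ?_⟩
        obtain ⟨h1, h2⟩ := hNS y' hy' z hz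
        simp only [Set.mem_sdiff, h1, h2, not_false_iff, and_true]
        exact hN y' hy' z hz

/-- A tree (given by directions) in which the vertices outside `R` are leaves attached to `R`, and
every edge inside `R` is a minimum cut for `c` between its ends. -/
structure IsPartialCutTree (c : Set V → ℝ) (R : Set V) (d : V → V → V) : Prop where
  isTreeDirection : IsTreeDirection d
  leaf : ∀ v ∉ R, ∃ r ∈ R, ∀ z, z ≠ v → d v z = r
  minCut : ∀ u ∈ R, ∀ y ∈ R, u ≠ y → d u y = y → ∀ Z : Set V, y ∈ Z → u ∉ Z →
    c {z | d u z = y} ≤ c Z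

/-- Take a minimum cut `X` between `v` and its neighbour `r`, uncrossed from the branches at `r`,
and split `r` along it. The new edge has `X` as one side; the other settled edges keep their
bipartition, so only edges moved from `r` to `v` need a new minimality argument. -/
theorem IsPartialCutTree.insert [Finite V] {c : Set V → ℝ} (hcompl : ∀ X, c Xᶜ = c X)
    (hsub : ∀ X Y, c (X ∩ Y) + c (X ∪ Y) ≤ c X + c Y)
    (hsdiff : ∀ X Y, c (X \ Y) + c (Y \ X) ≤ c X + c Y) {R : Set V} {d : V → V → V}
    (h : IsPartialCutTree c R d) {v : V} (hv : v ∉ R) :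
    ∃ d', IsPartialCutTree c (insert v R) d' := by
  classical
  obtain ⟨hd, hleaf, hmin⟩ := h
  obtain ⟨r, hrR, hvleaf⟩ := hleaf v hv
  have hrv : r ≠ v := fun h => hv (h ▸ hrR)
  have hvr : d v r = r := hvleaf r hrv
  have hrv' : d r v = v := hd.symm hrv.symm hvr
  obtain ⟨X, hvX, hrX, hXmin, hXN⟩ := exists_minCut_uncrossed hsub hsdiff (f := d r) hrv
    (Set.toFinite {y | y ∈ R ∧ y ≠ r ∧ d r y = y}).toFinset
    (fun y hy => ((Set.Finite.mem_toFinset _).1 hy).2.2)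
    (fun y hy h => ((Set.Finite.mem_toFinset _).1 hy).2.1 (by rw [← h, hd.self]))
    (fun y hy h => hv (by rw [← hrv', h]; exact ((Set.Finite.mem_toFinset _).1 hy).1))
    (fun y hy => by
      obtain ⟨h1, h2, h3⟩ := (Set.Finite.mem_toFinset _).1 hy
      exact hmin r hrR y h1 h2.symm h3)
  have hX : ∀ z, z ∈ X ↔ d r z ∈ X := by
    intro z
    by_cases hz : z = r
    · rw [hz, hd.self]
    by_cases hR : d r z ∈ R
    · exact hXN _ ((Set.Finite.mem_toFinset _).2 ⟨hR, hd.ne r z hz, hd.idem r z⟩) z rfl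
    -- A neighbour of `r` outside `R` is a leaf, so its branch is a singleton and cannot cross `X`.
    · obtain ⟨r', -, hr'⟩ := hleaf _ hR
      have hadj := hd.adj_apply hz
      have hside := hd.side r (d r z) hadj.1 hadj.2.1 z
      by_cases hzz : z = d r z
      · rw [← hzz]
      · exact absurd ((hr' z hzz).trans ((hr' r hadj.1).symm.trans hadj.2.2)) (hside.1 rfl)
  have hd' := hd.split hvX hrX hvleaf hX
  have hyv : ∀ y z, y ≠ v → d y z = v → y = r := by
    intro y z hy hz
    have h1 : d y v = v := by rw [← hz, hd.idem, hz]
    have h2 := hd.symm hy h1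
    rw [hvleaf y hy] at h2
    exact h2.symm
  -- minimality of the branch at a reattached neighbour of `r`
  have hre : ∀ y ∈ R, y ∈ X → d r y = y → ∀ Z : Set V, y ∈ Z → v ∉ Z →
      c {z | d r z = y} ≤ c Z := by
    intro y hyR hyX hry Z hyZ hvZ
    have hyr : r ≠ y := fun h => hrX (h ▸ hyX)
    -- If `r ∈ Z`, then `Z` also separates `v` from `r`, so it is at least as heavy as `X`, itself a
    -- cut between `y` and `r`.
    by_cases hrZ : r ∈ Z
    · have h1 := hXmin Zᶜ hvZ (fun h => h hrZ)
      rw [hcompl] at h1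
      exact (hmin r hrR y hyR hyr hry X hyX hrX).trans h1
    · exact hmin r hrR y hyR hyr hry Z hyZ hrZ
  refine ⟨splitDirection d r v X, hd', fun u hu => ?_, ?_⟩
  · rw [Set.mem_insert_iff, not_or] at hu
    obtain ⟨r', hr', h⟩ := hleaf u hu.2
    have hur : u ≠ r := fun h => hu.2 (h ▸ hrR)
    refine ⟨if r' = r ∧ u ∈ X then v else r', ?_, fun z hz => ?_⟩
    · split_ifs
      · exact Set.mem_insert _ _
      · exact Set.mem_insert_of_mem _ hr'
    · simp only [splitDirection, hur, hu.1, if_false, h z hz]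
  · intro u hu y hy huy huy' Z hyZ huZ
    have hside' := hd'.side u y huy huy'
    by_cases hur : u = r
    · subst hur
      by_cases hyX : y ∈ X
      · have hyv' : y = v := by rw [← huy']; simp [splitDirection, hyX]
        subst hyv'
        have : {z | splitDirection d u y X u z = y} = X := by
          ext z
          have := hX z
          simp only [splitDirection, if_true, Set.mem_ofPred_eq]
          split_ifs with hz
          · simp [hz]
          · simp only [hz, iff_false]
            rintro h
            exact hz (this.2 (h ▸ hvX))
        rw [this]
        exact hXmin Z hyZ huZ
      · have hyv' : y ≠ v := fun h => hyX (h ▸ hvX)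
        have huy0 : d u y = y := by simpa [splitDirection, hyX] using huy'
        have : {z | splitDirection d u v X u z = y} = {z | d u z = y} := by
          ext z
          have := hX z
          simp only [splitDirection, if_true, Set.mem_ofPred_eq]
          split_ifs with hz
          · refine iff_of_false hyv'.symm fun h => hyX ?_
            rw [← h]
            exact this.1 hz
          · rfl
        rw [this]
        exact hmin u hrR y (hy.resolve_left hyv') huy huy0 Z hyZ huZ
    by_cases huv : u = v
    · subst huv
      by_cases hyX : y ∈ X
      · have hry : d r y = y := by
          simpa [splitDirection, hur, huy.symm, hyX] using huy'
        have hyr : r ≠ y := fun h => hrX (h ▸ hyX)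
        have : {z | splitDirection d r u X u z = y} = {z | d r z = y} := by
          ext z
          have := hX z
          simp only [splitDirection, hur, if_true, if_false, Set.mem_ofPred_eq]
          split_ifs with hz hz'
          · rw [hz, hrv']
          · rfl
          · refine iff_of_false hyr fun h => hz' (this.2 (h ▸ hyX))
        rw [this]
        exact hre y (hy.resolve_left huy.symm) hyX hry Z hyZ huZ
      · have hyr : r = y := by
          simpa [splitDirection, hur, huy.symm, hyX] using huy'
        subst hyr
        have : {z | splitDirection d r u X u z = r} = Xᶜ := by
          ext z
          have := hX z
          simp only [splitDirection, hur, if_true, if_false, Set.mem_ofPred_eq, Set.mem_compl_iff]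
          split_ifs with hz hz'
          · rw [hz]
            exact iff_of_false huy (fun h => h hvX)
          · refine iff_of_false (fun h => hrX (h ▸ this.1 hz')) (fun h => h hz')
          · exact iff_of_true rfl hz'
        rw [this, hcompl, ← hcompl Z]
        exact hXmin Zᶜ huZ (fun h => h hyZ)
    have huR := hu.resolve_left huv
    by_cases hyv' : y = v
    · subst hyv'
      -- The only settled neighbours of `v` other than `r` are those moved from `r`; seen from them,
      -- the branch of `v` is the complement of their old branch.
      have huX : d u y = r ∧ u ∈ X := by
        by_contra hcon
        simp only [splitDirection, hur, huv, if_false, hcon] at huy'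
        exact hur (hyv u y huv huy')
      have hur' : d u r = r := by rw [← huX.1, hd.idem]
      have hru : d r u = u := hd.symm hur hur'
      have : {z | splitDirection d r y X u z = y} = {z | d r z = u}ᶜ := by
        ext z
        have hs := hd.side u r hur hur' z
        simp only [splitDirection, hur, huv, if_false, Set.mem_ofPred_eq, Set.mem_compl_iff,
          huX.2, and_true]
        split_ifs with hz
        · exact iff_of_true rfl (hs.1 hz)
        · exact iff_of_false (fun h => hur (hyv u z huv h)) (fun h => hz (hs.2 h))
      rw [this, hcompl, ← hcompl Z]
      exact hre u huR huX.2 hru Zᶜ huZ (fun h => h hyZ)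
    · have hyR := hy.resolve_left hyv'
      have hnot : ¬ (d u y = r ∧ u ∈ X) := by
        intro hcon
        simp only [splitDirection, hur, huv, if_false, hcon, and_self, if_true] at huy'
        exact hyv' huy'.symm
      have huy0 : d u y = y := by
        simpa only [splitDirection, hur, huv, if_false, hnot] using huy'
      have : {z | splitDirection d r v X u z = y} = {z | d u z = y} := by
        ext z
        simp only [splitDirection, hur, huv, if_false, Set.mem_ofPred_eq]
        split_ifs with hz
        · refine iff_of_false (Ne.symm hyv') fun h => hnot ⟨?_, hz.2⟩
          rw [huy0, ← h, hz.1]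
        · rfl
      rw [this]
      exact hmin u huR y hyR huy huy0 Z hyZ huZ

theorem exists_isPartialCutTree_univ [Finite V] [Nonempty V] {c : Set V → ℝ}
    (hcompl : ∀ X, c Xᶜ = c X) (hsub : ∀ X Y, c (X ∩ Y) + c (X ∪ Y) ≤ c X + c Y)
    (hsdiff : ∀ X Y, c (X \ Y) + c (Y \ X) ≤ c X + c Y) :
    ∃ d, IsPartialCutTree c Set.univ d := by
  classical
  have := Fintype.ofFinite V
  obtain ⟨r⟩ := ‹Nonempty V›
  suffices h : ∀ s : Finset V, ∃ d, IsPartialCutTree c (insert r (s : Set V)) d by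
    obtain ⟨d, hd⟩ := h Finset.univ
    rw [Finset.coe_univ, Set.insert_eq_of_mem (Set.mem_univ r)] at hd
    exact ⟨d, hd⟩
  intro s
  induction s using Finset.induction_on with
  | empty =>
    refine ⟨_, isTreeDirection_star r, fun v hv => ⟨r, by simp, fun z hz => ?_⟩, ?_⟩
    · have : v ≠ r := by simpa using hv
      simp [this, hz]
    · intro u hu y hy huy
      simp only [Finset.coe_empty, Set.mem_insert_iff, Set.mem_empty_iff_false, or_false] at hu hy
      exact absurd (hu.trans hy.symm) huy
  | insert v s _ ih =>
    obtain ⟨d, hd⟩ := ih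
    rw [Finset.coe_insert, Set.insert_comm]
    by_cases hv : v ∈ insert r (s : Set V)
    · rw [Set.insert_eq_of_mem hv]
      exact ⟨d, hd⟩
    · exact hd.insert hcompl hsub hsdiff hv

/-- Every nonempty graph with nonnegative edge weights has a Gomory-Hu tree. -/
theorem exists_isGomoryHuTree [Fintype V] [DecidableEq V] [Nonempty V] {G : SimpleGraph V}
    {w : Sym2 V → ℝ} (hw : ∀ e ∈ G.edgeSet, 0 ≤ w e) : ∃ H wH, IsGomoryHuTree G w H wH := by
  obtain ⟨d, hd⟩ := exists_isPartialCutTree_univ (c := fun X => edgeSetWeight w (cutEdges G X))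
    (fun X => by rw [cutEdges_compl]) (edgeSetWeight_cutEdges_inter_add_union hw)
    (edgeSetWeight_cutEdges_sdiff_add_sdiff hw)
  refine ⟨directionGraph d, _, isGomoryHuTree_of_forall_adj hw hd.isTreeDirection.isTree ?_⟩
  intro a b hab Z ha hb
  rw [treeEdgeCut_eq_cutEdges (X := {z | d a z = b})
    (hd.isTreeDirection.reachable_deleteEdges_iff hab.1 hab.2.1), ← cutEdges_compl Z]
  exact hd.minCut a (Set.mem_univ a) b (Set.mem_univ b) hab.1 hab.2.1 Zᶜ hb fun h => h ha

end GomoryHu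

/-! ### `k`-Cut as a special case, and feasibility on trees -/

section KCut

/-- Single-to-Single with all candidate sets equal to `V` is `k`-Cut. -/
theorem isSingleToSingleCut_univ_iff {V : Type*} [Finite V] (G : SimpleGraph V) (k : ℕ)
    (C : Finset (Sym2 V)) :
    IsSingleToSingleCut G (fun _ : Fin k => (Set.univ : Set V)) C ↔ IsKCut G k C := by
  refine and_congr_right fun _ => ⟨?_, fun hk => ?_⟩
  · rintro ⟨t, -, ht⟩
    have hinj : Function.Injective fun i =>
        (G.deleteEdges (C : Set (Sym2 V))).connectedComponentMk (t i) := by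
      intro i j hij
      by_contra hne
      exact ht i j hne (SimpleGraph.ConnectedComponent.eq.1 hij)
    simpa using Nat.card_le_card_of_injective _ hinj
  · have := Fintype.ofFinite (G.deleteEdges (C : Set (Sym2 V))).ConnectedComponent
    obtain ⟨f⟩ := Function.Embedding.nonempty_of_card_le (α := Fin k)
      (β := (G.deleteEdges (C : Set (Sym2 V))).ConnectedComponent)
      (by rwa [Fintype.card_fin, ← Nat.card_eq_fintype_card])
    choose t ht using fun i => (f i).exists_rep
    refine ⟨t, fun i => Set.mem_univ _, fun i j hij hr => hij (f.injective ?_)⟩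
    rw [← ht i, ← ht j]
    exact SimpleGraph.ConnectedComponent.sound hr

/-- A solution on `G` yields one on every tree, namely the set of all edges. -/
theorem IsSingleToSingleCut.exists_of_finite {V : Type*} [Finite V] {G : SimpleGraph V} {q : ℕ}
    {T : Fin q → Set V} {C : Finset (Sym2 V)} (hC : IsSingleToSingleCut G T C)
    (H : SimpleGraph V) : ∃ C', IsSingleToSingleCut H T C' := by
  obtain ⟨-, t, htT, ht⟩ := hC
  refine ⟨(Set.toFinite H.edgeSet).toFinset, by simp, t, htT, fun i j hij hr => ht i j hij ?_⟩
  rw [Set.Finite.coe_toFinset, SimpleGraph.deleteEdges_eq_bot.2 subset_rfl,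
    SimpleGraph.reachable_bot] at hr
  rw [hr]

end KCut

theorem mainTheorem2 {V : Type*} [Fintype V] [DecidableEq V] (G : SimpleGraph V)
    (w : Sym2 V → ℝ) (hw : ∀ e ∈ G.edgeSet, 0 ≤ w e) :
    (∀ (q : ℕ) (T : Fin q → Set V), 1 ≤ q → (∃ C, IsSingleToSingleCut G T C) →
      (∃ D, IsGomoryHuGreedyOutput G w T D) ∧
      (∀ (H : SimpleGraph V) (wH : Sym2 V → ℝ), IsGomoryHuTree G w H wH →
        (∀ F, GreedyReachable H wH T F → F.card + 1 < q → ∃ F', GreedyStep H wH T F F') ∧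
        (∀ F, IsGreedyOutput H wH T F →
          IsApproxSolution (IsSingleToSingleCut H T) wH 1 F)) ∧
      (∀ D, IsGomoryHuGreedyOutput G w T D →
        IsApproxSolution (IsSingleToSingleCut G T) w (2 - 2 / (q : ℝ)) D)) ∧
    (∀ (k : ℕ) (C : Finset (Sym2 V)),
      (IsSingleToSingleCut G (fun _ : Fin k => (Set.univ : Set V)) C ↔ IsKCut G k C) ∧
      ∀ ρ : ℝ, IsApproxSolution (IsSingleToSingleCut G (fun _ : Fin k => (Set.univ : Set V))) w ρ C ↔
        IsApproxSolution (IsKCut G k) w ρ C) := by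
  refine ⟨fun q T hq ⟨C, hC⟩ => ?_, fun k C => ⟨isSingleToSingleCut_univ_iff G k C, fun ρ => ?_⟩⟩
  · have hne : ∀ i, (T i).Nonempty := fun i => ⟨_, hC.2.choose_spec.1 i⟩
    have : Nonempty V := (hne ⟨0, hq⟩).nonempty
    refine ⟨?_, fun H wH hGH => ⟨fun F hF hlt =>
        hF.exists_step hGH.isTree (hC.exists_of_finite H) hlt, fun F hF =>
        hF.isApproxSolution hGH.isTree (fun e he => hGH.nonneg hw he) hq hne⟩,
      fun D hD => hD.isApproxSolution hw hq hne⟩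
    obtain ⟨H, wH, hGH⟩ := exists_isGomoryHuTree hw
    obtain ⟨F, hF⟩ := exists_isGreedyOutput (wH := wH) hGH.isTree (hC.exists_of_finite H)
    exact ⟨_, H, wH, F, hGH, hF, rfl⟩
  · simp only [IsApproxSolution, isSingleToSingleCut_univ_iff]
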